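/- **Setting.** On anti-de Sitter space-time of curvature $\kappa>0$ use coordinates $(t,r,\theta,\varphi)$ with $r>0$, $0<\theta<\pi$ and the metric $$ds^2=(1+\kappa^2r^2)\,dt^2-(1+\kappa^2r^2)^{-1}dr^2-r^2(d\theta^2+\sin^2\theta\,d\varphi^2).$$ Let $T_0>0$, $\beta_0=1/T_0$, $\beta=\beta_0\partial_t$, $u=\beta/\sqrt{\beta^2}=\partial_t/\sqrt{g(\partial_t,\partial_t)}$ and $A_\mu=u^\nu\nabla_\nu u_\mu$. For $m\ge0$ put $$f_3(y)=\sum_{n\ge1}\frac{n^3}{e^{ny}-1},\qquad S_m=\sum_{n\ge1}\frac{(-1)^nn^m\sin(2n\arctan\kappa r)}{e^{n\kappa\beta_0}-1},\qquad C_m=\sum_{n\ge1}\frac{(-1)^nn^m\cos(2n\arctan\kappa r)}{e^{n\kappa\beta_0}-1}.$$ The vacuum-subtracted stress-energy tensor of the massless conformally coupled real scalar field at global equilibrium with four-temperature $\beta$ is given by Allen's exact solution $\langle T_{\mu\nu}\rangle=T^{\rm bulk}_{\mu\nu}\pm T^{\partial}_{\mu\nu}$ ($+$ for Dirichlet, $-$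 for Neumann boundary conditions), that is, the renormalized tensor $\frac{\kappa^4}{960\pi^2}g_{\mu\nu}+T^{\rm bulk}_{\mu\nu}\pm T^\partial_{\mu\nu}$ minus its anomaly term $\frac{\kappa^4}{960\pi^2}g_{\mu\nu}$, where $$T^{\rm bulk}_{\mu\nu}=\frac1{6\pi^2}\Big(\frac{\kappa^2}{1+\kappa^2r^2}\Big)^2f_3(\kappa\beta_0)\,(-g_{\mu\nu}+4u_\mu u_\nu)$$ and $$\begin{aligned}T^\partial_{\mu\nu}=\frac{\kappa^3}{8\pi^2r}\Big\{&\Big[\tfrac16\tfrac{1-\kappa^2r^2}{\kappa^2r^2}S_0-\tfrac1{3\kappa r}C_1-\tfrac23\tfrac1{1+\kappa^2r^2}S_2\Big]g_{\mu\nu}\\&+\Big[\tfrac16\big(3-\tfrac1{\kappa^2r^2}\big)S_0+\tfrac1{\kappa r}\big(1-\tfrac23\tfrac1{1+\kappa^2r^2}\big)C_1+\tfrac2{1+\kappa^2r^2}S_2\Big]u_\mu u_\nu\\&+\Big[\tfrac16\big(3\tfrac{1+\kappa^2r^2}{\kappa^2r^2}-4\big)S_0+\tfrac1{\kappa r}\big(\tfrac23\tfrac{\kappa^2r^2}{1+\kappa^2r^2}-1\big)C_1-\tfrac23\tfrac1{1+\kappa^2r^2}S_2\Big]\tfrac{1+\kappa^2r^2}{r^2\kappa^4}A_\mu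 A_\nu\Big\}.\end{aligned}$$ With $T_0$ and the point $(t,r,\theta,\varphi)$ fixed, each component is regarded as a function of the complex variable $z=\kappa^2$, with $\kappa=z^{1/2}$ the principal root, on the domain $D$ of all $z\in\mathbb C\setminus(-\infty,0]$ for which all the series converge. **Analytic distillate.** Let $f:D\to\mathbb C$ and $z_0\in\overline D$. Suppose that $D$ is a union of subsets $D_i$, each accumulating at $z_0$, on each of which $f$ has an expansion, asymptotic to all orders as $z\to z_0$, in the transmonomials $(z-z_0)^\alpha\log^k(z-z_0)$ ($\alpha\in\mathbb R$, $k\in\mathbb N$). Keep the coefficients of the pure powers $(z-z_0)^n$, $n=0,1,2,\dots$, that are common to all the $D_i$, and replace those that are not by zero. If the resulting power series has a positive radius of convergence, its sum, as a germ at $z_0$, is the analytic distillate $\mathrm{dist}_{z_0}f$. **Theorem.** 1. For every $\beta_0>0$ and $\varepsilon>0$, as $\kappa\to0$ in the sector $|\arg\kappa|\le\frac\pi2-\varepsilon$, to all orders in $\kappa$, $$\kappa^3f_3(\kappa\beta_0)\sim\frac{\pi^4}{15}\frac1{\kappa\beta_0^4}-\frac{\kappa^3}{240}.$$ 2. For $T_0>0$,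 for both boundary conditions and at every point with $r>0$, $0<\theta<\pi$, the analytic distillate in $\kappa^2=0$ of each component of $\langle T_{\mu\nu}\rangle$ exists, is unique, and is $$\mathrm{dist}_{\kappa^2=0}\langle T_{\mu\nu}\rangle=\Big(\frac{\pi^2}{90}T_0^4-\frac{\kappa^4}{1440\pi^2}\Big)\Big(\frac1{1+\kappa^2r^2}\Big)^2(-g_{\mu\nu}+4u_\mu u_\nu).$$ 3. For $\kappa>0$ and $T_0>0$, the tensor on the right-hand side is traceless and covariantly conserved. 4. For $\kappa>0$ and $T_0\ge0$, the tensor on the right-hand side vanishes at a point if and only if $T_0=\kappa/2\pi$; in particular it does not vanish at $T_0=0$. -/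

import Mathlib

open Filter Topology Asymptotics

noncomputable section

namespace AdSDistillate

/-! ### Transseries expansions and the analytic distillate -/

/-- The function `f` has, as `z → z₀` inside `S`, the expansion
`f z ∼ ∑ α, ∑ k, (a α).coeff k * (log (z - z₀)) ^ k * (z - z₀) ^ α`
over the group of transmonomials `(z - z₀) ^ α * (log (z - z₀)) ^ k`, with `α` real and `k` a natural
number (principal branches). The exponents form a set that is finite below every bound, and the
expansion is asymptotic to all orders. Exponentially small transmonomials are smaller than
every power, so they are absorbed in the remainder. -/
def HasTransseries (f : ℂ → ℂ) (S : Set ℂ) (z₀ : ℂ) (a : ℝ → Polynomial ℂ) : Prop :=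
  ∀ N : ℝ, ∃ E : Finset ℝ, (∀ α : ℝ, α ∈ E ↔ α ≤ N ∧ a α ≠ 0) ∧
    (fun z : ℂ => f z - ∑ α ∈ E, (a α).eval (Complex.log (z - z₀)) * (z - z₀) ^ (α : ℂ))
      =o[𝓝[S \ {z₀}] z₀] (fun z : ℂ => ‖z - z₀‖ ^ N)

/-- `g` is an analytic distillate of `f : D → ℂ` in `z₀ ∈ closure D`. There are subsets of `D`, with
union `D` and each accumulating at `z₀`, on which `f` has transseries expansions; the coefficient
`c n` of the pure power `(z - z₀) ^ n` is kept if it is common to all the subsets and is dropped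
(replaced by zero) if it is not; and the power series with coefficients `c n` converges to `g` near
`z₀`. Only the germ of `g` at `z₀` matters. -/
def IsDistillate (f : ℂ → ℂ) (D : Set ℂ) (z₀ : ℂ) (g : ℂ → ℂ) : Prop :=
  z₀ ∈ closure D ∧
  ∃ (𝒟 : Set (Set ℂ)) (a : Set ℂ → ℝ → Polynomial ℂ) (c : ℕ → ℂ),
    ⋃₀ 𝒟 = D ∧
    (∀ S ∈ 𝒟, z₀ ∈ closure (S \ {z₀}) ∧ HasTransseries f S z₀ (a S)) ∧
    (∀ n : ℕ, (∀ S ∈ 𝒟, (a S (n : ℝ)).coeff 0 = c n) ∨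
      (c n = 0 ∧ ∃ S ∈ 𝒟, ∃ S' ∈ 𝒟, (a S (n : ℝ)).coeff 0 ≠ (a S' (n : ℝ)).coeff 0)) ∧
    (∀ᶠ z in 𝓝 z₀, HasSum (fun n : ℕ => c n * (z - z₀) ^ n) (g z))

/-! ### Geometry

Coordinates are `x = (t, r, θ, φ)`, the signature is `(+,-,-,-)`. The square `k2 = κ ^ 2` of the
curvature parameter is allowed to be complex. -/

/-- The coordinate chart `r > 0`, `0 < θ < π`. -/
def chart : Set (Fin 4 → ℝ) := {x | 0 < x 1 ∧ 0 < x 2 ∧ x 2 < Real.pi}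

/-- `g_{μν}`: the line element
`(1 + κ²r²) dt² - (1 + κ²r²)⁻¹ dr² - r² (dθ² + sin² θ dφ²)`. -/
def metric (k2 : ℂ) (x : Fin 4 → ℝ) : Matrix (Fin 4) (Fin 4) ℂ :=
  Matrix.diagonal ![1 + k2 * (x 1 : ℂ) ^ 2, -(1 + k2 * (x 1 : ℂ) ^ 2)⁻¹,
    -(x 1 : ℂ) ^ 2, -((x 1 : ℂ) ^ 2 * (Real.sin (x 2) : ℂ) ^ 2)]

/-- `∂_μ F` for a function of the coordinates. -/
def partialDeriv (μ : Fin 4) (F : (Fin 4 → ℝ) → ℂ) (x : Fin 4 → ℝ) : ℂ :=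
  deriv (fun s : ℝ => F (Function.update x μ s)) (x μ)

/-- The Christoffel symbols `Γ^l_{μν}` of the Levi-Civita connection of `metric k2`. -/
def christoffel (k2 : ℂ) (l μ ν : Fin 4) (x : Fin 4 → ℝ) : ℂ :=
  (1 / 2) * ∑ σ : Fin 4, (metric k2 x)⁻¹ l σ *
    (partialDeriv μ (fun y => metric k2 y σ ν) x + partialDeriv ν (fun y => metric k2 y σ μ) x
      - partialDeriv σ (fun y => metric k2 y μ ν) x)

/-- The Killing vector `ξ^μ = (1, 0, 0, 0)`; the four-temperature is `β^μ = ξ^μ / T₀`. -/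
def killing : Fin 4 → ℂ := ![1, 0, 0, 0]

/-- The contravariant four-velocity `u^μ = β^μ / √β² = ξ^μ / √ξ²`. -/
def velocityUp (k2 : ℂ) (x : Fin 4 → ℝ) (μ : Fin 4) : ℂ :=
  killing μ / (∑ α : Fin 4, ∑ β : Fin 4, metric k2 x α β * killing α * killing β) ^ (1 / 2 : ℂ)

/-- The covariant four-velocity `u_μ`. -/
def velocity (k2 : ℂ) (x : Fin 4 → ℝ) (μ : Fin 4) : ℂ :=
  ∑ ν : Fin 4, metric k2 x μ ν * velocityUp k2 x ν

/-- The four-acceleration `A_μ = u^ν ∇_ν u_μ`. -/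
def acceleration (k2 : ℂ) (x : Fin 4 → ℝ) (μ : Fin 4) : ℂ :=
  ∑ ν : Fin 4, velocityUp k2 x ν * (partialDeriv ν (fun y => velocity k2 y μ) x
    - ∑ l : Fin 4, christoffel k2 l ν μ x * velocity k2 x l)

/-- `g^{μν} T_{μν}`. -/
def traceTensor (k2 : ℂ) (T : (Fin 4 → ℝ) → Fin 4 → Fin 4 → ℂ) (x : Fin 4 → ℝ) : ℂ :=
  ∑ μ : Fin 4, ∑ ν : Fin 4, (metric k2 x)⁻¹ μ ν * T x μ ν

/-- `T^{μν} = g^{μα} g^{νβ} T_{αβ}`. -/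
def raiseTensor (k2 : ℂ) (T : (Fin 4 → ℝ) → Fin 4 → Fin 4 → ℂ)
    (x : Fin 4 → ℝ) (μ ν : Fin 4) : ℂ :=
  ∑ α : Fin 4, ∑ β : Fin 4, (metric k2 x)⁻¹ μ α * (metric k2 x)⁻¹ ν β * T x α β

/-- The covariant divergence `∇_μ T^{μν}` of the tensor with covariant components `T_{μν}`. -/
def divergence (k2 : ℂ) (T : (Fin 4 → ℝ) → Fin 4 → Fin 4 → ℂ)
    (x : Fin 4 → ℝ) (ν : Fin 4) : ℂ :=
  ∑ μ : Fin 4, (partialDeriv μ (fun y => raiseTensor k2 T y μ ν) x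
    + ∑ l : Fin 4, (christoffel k2 μ μ l x * raiseTensor k2 T x l ν
      + christoffel k2 ν μ l x * raiseTensor k2 T x μ l))

/-! ### The exact thermal stress-energy tensor

The summation index `n ≥ 1` of the series is written as `n + 1` with `n : ℕ`. -/

/-- The terms of `f₃(y) = ∑_{n ≥ 1} n³ / (e^{n y} - 1)`. -/
def f3Term (y : ℂ) (n : ℕ) : ℂ :=
  ((n : ℂ) + 1) ^ 3 / (Complex.exp (((n : ℂ) + 1) * y) - 1)

def f3 (y : ℂ) : ℂ := ∑' n : ℕ, f3Term y n

/-- The terms of `S_m(κβ₀, r) = ∑_{n ≥ 1} n^m (-1)^n sin (2 n arctan (κ r)) / (e^{n κ β₀} - 1)`. -/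
def sinTerm (m : ℕ) (κ : ℂ) (β₀ r : ℝ) (n : ℕ) : ℂ :=
  ((n : ℂ) + 1) ^ m * (-1) ^ (n + 1) / (Complex.exp (((n : ℂ) + 1) * (κ * (β₀ : ℂ))) - 1)
    * Complex.sin (2 * ((n : ℂ) + 1) * Complex.arctan (κ * (r : ℂ)))

def sinSeries (m : ℕ) (κ : ℂ) (β₀ r : ℝ) : ℂ := ∑' n : ℕ, sinTerm m κ β₀ r n

/-- The terms of `C_m(κβ₀, r) = ∑_{n ≥ 1} n^m (-1)^n cos (2 n arctan (κ r)) / (e^{n κ β₀} - 1)`. -/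
def cosTerm (m : ℕ) (κ : ℂ) (β₀ r : ℝ) (n : ℕ) : ℂ :=
  ((n : ℂ) + 1) ^ m * (-1) ^ (n + 1) / (Complex.exp (((n : ℂ) + 1) * (κ * (β₀ : ℂ))) - 1)
    * Complex.cos (2 * ((n : ℂ) + 1) * Complex.arctan (κ * (r : ℂ)))

def cosSeries (m : ℕ) (κ : ℂ) (β₀ r : ℝ) : ℂ := ∑' n : ℕ, cosTerm m κ β₀ r n

/-- The traceless tensor `-g_{μν} + 4 u_μ u_ν`. -/
def radiationTensor (k2 : ℂ) (x : Fin 4 → ℝ) (μ ν : Fin 4) : ℂ :=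
  -metric k2 x μ ν + 4 * velocity k2 x μ * velocity k2 x ν

/-- The bulk term of the stress-energy tensor. -/
def bulkTensor (T₀ : ℝ) (κ : ℂ) (x : Fin 4 → ℝ) (μ ν : Fin 4) : ℂ :=
  1 / (6 * (Real.pi : ℂ) ^ 2) * (κ ^ 2 / (1 + κ ^ 2 * (x 1 : ℂ) ^ 2)) ^ 2
    * f3 (κ * ((1 / T₀ : ℝ) : ℂ)) * radiationTensor (κ ^ 2) x μ ν

/-- The boundary term of the stress-energy tensor. -/
def boundaryTensor (T₀ : ℝ) (κ : ℂ) (x : Fin 4 → ℝ) (μ ν : Fin 4) : ℂ :=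
  let r : ℂ := (x 1 : ℂ)
  let S₀ : ℂ := sinSeries 0 κ (1 / T₀) (x 1)
  let C₁ : ℂ := cosSeries 1 κ (1 / T₀) (x 1)
  let S₂ : ℂ := sinSeries 2 κ (1 / T₀) (x 1)
  κ ^ 3 / (8 * (Real.pi : ℂ) ^ 2 * r) *
    ((1 / 6 * ((1 - κ ^ 2 * r ^ 2) / (κ ^ 2 * r ^ 2)) * S₀ - 1 / (3 * κ * r) * C₁
        - 2 / 3 * (1 / (1 + κ ^ 2 * r ^ 2)) * S₂) * metric (κ ^ 2) x μ ν
      + (1 / 6 * (3 - 1 / (κ ^ 2 * r ^ 2)) * S₀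
        + 1 / (κ * r) * (1 - 2 / 3 * (1 / (1 + κ ^ 2 * r ^ 2))) * C₁
        + 2 / (1 + κ ^ 2 * r ^ 2) * S₂) * velocity (κ ^ 2) x μ * velocity (κ ^ 2) x ν
      + (1 / 6 * (3 * ((1 + κ ^ 2 * r ^ 2) / (κ ^ 2 * r ^ 2)) - 4) * S₀
        + 1 / (κ * r) * (2 / 3 * (κ ^ 2 * r ^ 2 / (1 + κ ^ 2 * r ^ 2)) - 1) * C₁
        - 2 / 3 * (1 / (1 + κ ^ 2 * r ^ 2)) * S₂)
          * ((1 + r ^ 2 * κ ^ 2) / (r ^ 2 * κ ^ 4))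
          * acceleration (κ ^ 2) x μ * acceleration (κ ^ 2) x ν)

/-- The conformal anomaly, which is the expectation value in the vacuum of the Killing vector. -/
def anomalyTensor (κ : ℂ) (x : Fin 4 → ℝ) (μ ν : Fin 4) : ℂ :=
  κ ^ 4 / (960 * (Real.pi : ℂ) ^ 2) * metric (κ ^ 2) x μ ν

inductive BoundaryCondition where
  | dirichlet
  | neumann

/-- The sign of the boundary term. -/
def BoundaryCondition.sign : BoundaryCondition → ℂ
  | .dirichlet => 1
  | .neumann => -1

/-- The renormalized stress-energy tensor at temperature `T₀ = 1 / β₀`. -/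
def renormalizedTensor (bc : BoundaryCondition) (T₀ : ℝ) (κ : ℂ) (x : Fin 4 → ℝ)
    (μ ν : Fin 4) : ℂ :=
  anomalyTensor κ x μ ν + bulkTensor T₀ κ x μ ν + bc.sign * boundaryTensor T₀ κ x μ ν

/-- The vacuum-subtracted stress-energy tensor. -/
def vacuumSubtractedTensor (bc : BoundaryCondition) (T₀ : ℝ) (κ : ℂ) (x : Fin 4 → ℝ)
    (μ ν : Fin 4) : ℂ :=
  renormalizedTensor bc T₀ κ x μ ν - anomalyTensor κ x μ ν

/-- The principal square root `κ` of `κ²`; it has positive real part on the slit plane. -/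
def root (z : ℂ) : ℂ := z ^ (1 / 2 : ℂ)

/-- The domain of existence in the variable `z = κ²` at radius `r`: `z` lies in the plane slit along
the non-positive reals, and all the series in the stress-energy tensor converge. -/
def domain (T₀ r : ℝ) : Set ℂ :=
  {z | z ∈ Complex.slitPlane ∧ Summable (f3Term (root z * ((1 / T₀ : ℝ) : ℂ))) ∧
    Summable (sinTerm 0 (root z) (1 / T₀) r) ∧ Summable (cosTerm 1 (root z) (1 / T₀) r) ∧
    Summable (sinTerm 2 (root z) (1 / T₀) r)}

/-- The tensor `(π² T₀⁴ / 90 - κ⁴ / (1440 π²)) (1 + κ² r²)⁻² (-g_{μν} + 4 u_μ u_ν)`, with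
`k2 = κ²`. -/
def distilledTensor (T₀ : ℝ) (k2 : ℂ) (x : Fin 4 → ℝ) (μ ν : Fin 4) : ℂ :=
  ((Real.pi : ℂ) ^ 2 / 90 * (T₀ : ℂ) ^ 4 - k2 ^ 2 / (1440 * (Real.pi : ℂ) ^ 2))
    * (1 / (1 + k2 * (x 1 : ℂ) ^ 2)) ^ 2 * radiationTensor k2 x μ ν

end AdSDistillate

end

namespace AdSDistillate

/-! ### Transseries expansions -/

/-! Put w = κβ₀ and a = arctan κr. All the series have short expansions as κ → 0, with remainders
that are exponentially small in Re(1/w). The bulk series is the Lambert series of the Eisenstein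
series of weight four. The inversion τ ↦ -1/τ turns it into a pole, a constant and a Lambert series
at 4π²/w (`lambert_three`); the constant -1/240 produces the κ⁴ term of the distillate. For the
boundary, expanding 1/(e^{nw} - 1) geometrically turns S₂ into a sum of (v + jτ + m)⁻³ over the
lattice with its row j = 0 missing, where v = 1/2 + a/π and τ = iw/2π (`sinSum_two_eq`). The missing
row is explicit, and the complete sum, taken in the other order, is exponentially small; hence S₂ ∼
-tan a / (8 cos² a). Since dC₁/da = -2 S₂ and dS₀/da = 2 C₁, two integrations from a = 0 give C₁ ∼
-1/(2w) + 1/(8 cos² a) and S₀ ∼ -a/w + tan a / 4. The constant of integration of C₁ comes from the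
quasimodularity of E₂; that of S₀ is zero (`norm_boundary_remainders_le`). In the boundary tensor
the parts without 1/w cancel identically (`vacuum_cancellation`). What is left is analytic and odd
in κ, so it contains only half-odd powers of κ² and is invisible to the distillate; both boundary
conditions thus have the same distillate. The remainders beat every power of κ only in a sector Re κ
≥ c|κ|. The domain provides one near the origin: convergence of S₂ forces 2|Im a| < Re w, while a is
close to κr (`eventually_domain_sector`). There is thus a single expansion on the whole domain.
Expansions are unique on any set accumulating at the point (`HasTransseries.unique`), so no other
cover of the domain can change the result. Tracelessness, conservation and the zero are computations
with diagonal tensors. -/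

theorem HasTransseries.mono {f : ℂ → ℂ} {S S' : Set ℂ} {z₀ : ℂ} {a : ℝ → Polynomial ℂ}
    (h : HasTransseries f S z₀ a) (hS : S' ⊆ S) : HasTransseries f S' z₀ a := by
  intro N
  obtain ⟨E, hE, ho⟩ := h N
  exact ⟨E, hE, ho.mono (nhdsWithin_mono _ (Set.sdiff_subset_sdiff_left hS))⟩

/-- The real part of the logarithm is the logarithm of the modulus, which tends to -∞ whatever the
argument does. This lets polynomials in the logarithm be compared with constants. -/
theorem tendsto_norm_log_sub_atTop (S : Set ℂ) (z₀ : ℂ) :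
    Tendsto (fun z : ℂ => ‖Complex.log (z - z₀)‖) (𝓝[S \ {z₀}] z₀) atTop := by
  have h1 : Tendsto (fun z : ℂ => ‖z - z₀‖) (𝓝[S \ {z₀}] z₀) (𝓝[≠] 0) := by
    refine tendsto_nhdsWithin_iff.2 ⟨?_, ?_⟩
    · have : Tendsto (fun z : ℂ => ‖z - z₀‖) (𝓝 z₀) (𝓝 ‖z₀ - z₀‖) := by
        apply Continuous.tendsto; fun_prop
      simpa using this.mono_left nhdsWithin_le_nhds
    · filter_upwards [self_mem_nhdsWithin] with z hz
      simpa [sub_eq_zero] using hz.2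
  have h2 : Tendsto (fun z : ℂ => -Real.log ‖z - z₀‖) (𝓝[S \ {z₀}] z₀) atTop :=
    tendsto_neg_atBot_atTop.comp (Real.tendsto_log_nhdsNE_zero.comp h1)
  refine tendsto_atTop_mono (fun z => ?_) h2
  refine le_trans ?_ (Complex.abs_re_le_norm _)
  rw [Complex.log_re]
  exact neg_le_abs _

/-- At the smallest exponent where the coefficients differ, subtracting the two expansions leaves a
nonzero polynomial in log(z - z₀) that tends to zero. A polynomial of positive degree blows up
there, and a constant one would have to be zero. -/
theorem HasTransseries.unique {f : ℂ → ℂ} {S : Set ℂ} {z₀ : ℂ} {a b : ℝ → Polynomial ℂ}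
    (ha : HasTransseries f S z₀ a) (hb : HasTransseries f S z₀ b)
    (hS : z₀ ∈ closure (S \ {z₀})) : a = b := by
  classical
  have : (𝓝[S \ {z₀}] z₀).NeBot := mem_closure_iff_nhdsWithin_neBot.1 hS
  by_contra hne
  obtain ⟨α₁, hα₁⟩ := Function.ne_iff.1 hne
  obtain ⟨Ea, hEa, -⟩ := ha α₁
  obtain ⟨Eb, hEb, -⟩ := hb α₁
  -- Only finitely many exponents lie below `α₁` in either expansion, so a smallest exponent of
  -- disagreement exists.
  have hmem : ∀ α, α ≤ α₁ → a α ≠ b α → α ∈ (Ea ∪ Eb).filter (fun α => a α ≠ b α) := by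
    intro α h1 h2
    rw [Finset.mem_filter, Finset.mem_union, hEa, hEb]
    refine ⟨?_, h2⟩
    by_cases h : a α = 0
    · exact Or.inr ⟨h1, fun h' => h2 (h.trans h'.symm)⟩
    · exact Or.inl ⟨h1, h⟩
  have hnonempty : ((Ea ∪ Eb).filter (fun α => a α ≠ b α)).Nonempty := ⟨α₁, hmem α₁ le_rfl hα₁⟩
  obtain ⟨α₀, hα₀, hmin⟩ := Finset.exists_min_image _ id hnonempty
  have hP : a α₀ ≠ b α₀ := (Finset.mem_filter.1 hα₀).2
  have hmin' : ∀ α, α < α₀ → a α = b α := by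
    intro α h
    by_contra h'
    exact absurd (hmin α (hmem α (h.le.trans (hmin α₁ (hmem α₁ le_rfl hα₁))) h')) (not_le.2 h)
  obtain ⟨E, hE, hEo⟩ := ha α₀
  obtain ⟨E', hE', hEo'⟩ := hb α₀
  set F := E ∪ E'
  have hα₀F : α₀ ∈ F := by
    rw [Finset.mem_union, hE, hE']
    by_cases h : a α₀ = 0
    · exact Or.inr ⟨le_rfl, fun h' => hP (h.trans h'.symm)⟩
    · exact Or.inl ⟨le_rfl, h⟩
  have hle : ∀ α ∈ F, α ≤ α₀ := by
    intro α h
    rcases Finset.mem_union.1 h with h | h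
    · exact ((hE α).1 h).1
    · exact ((hE' α).1 h).1
  have key : (fun z : ℂ => (a α₀ - b α₀).eval (Complex.log (z - z₀)) * (z - z₀) ^ (α₀ : ℂ))
      =o[𝓝[S \ {z₀}] z₀] (fun z : ℂ => ‖z - z₀‖ ^ α₀) := by
    refine (hEo'.sub hEo).congr_left fun z => ?_
    have e1 : ∑ α ∈ E, (a α).eval (Complex.log (z - z₀)) * (z - z₀) ^ (α : ℂ)
        = ∑ α ∈ F, (a α).eval (Complex.log (z - z₀)) * (z - z₀) ^ (α : ℂ) := by
      refine Finset.sum_subset Finset.subset_union_left fun α h h' => ?_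
      have : a α = 0 := by
        by_contra h''
        exact h' ((hE α).2 ⟨hle α h, h''⟩)
      simp [this]
    have e2 : ∑ α ∈ E', (b α).eval (Complex.log (z - z₀)) * (z - z₀) ^ (α : ℂ)
        = ∑ α ∈ F, (b α).eval (Complex.log (z - z₀)) * (z - z₀) ^ (α : ℂ) := by
      refine Finset.sum_subset Finset.subset_union_right fun α h h' => ?_
      have : b α = 0 := by
        by_contra h''
        exact h' ((hE' α).2 ⟨hle α h, h''⟩)
      simp [this]
    rw [e1, e2, sub_sub_sub_cancel_left, ← Finset.sum_sub_distrib,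
      Finset.sum_eq_single_of_mem α₀ hα₀F, Polynomial.eval_sub]
    · ring
    · intro α h h'
      rw [hmin' α (lt_of_le_of_ne (hle α h) h'), sub_self]
  have hlim : Tendsto (fun z : ℂ => (a α₀ - b α₀).eval (Complex.log (z - z₀)))
      (𝓝[S \ {z₀}] z₀) (𝓝 0) := by
    rw [← isLittleO_one_iff ℝ, isLittleO_iff]
    intro c hc
    filter_upwards [isLittleO_iff.1 key hc, self_mem_nhdsWithin] with z hz hzS
    have hz0 : z - z₀ ≠ 0 := sub_ne_zero.2 hzS.2
    have hpos : 0 < ‖z - z₀‖ ^ α₀ := Real.rpow_pos_of_pos (norm_pos_iff.2 hz0) _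
    rw [norm_mul, Complex.norm_cpow_real, Real.norm_of_nonneg hpos.le] at hz
    simpa using le_of_mul_le_mul_right hz hpos
  have hne0 : a α₀ - b α₀ ≠ 0 := sub_ne_zero.2 hP
  by_cases hdeg : 0 < (a α₀ - b α₀).degree
  · exact not_tendsto_atTop_of_tendsto_nhds hlim.norm
      (Polynomial.tendsto_norm_atTop _ hdeg (tendsto_norm_log_sub_atTop S z₀))
  · have hC := Polynomial.eq_C_of_degree_le_zero (not_lt.1 hdeg)
    rw [hC] at hlim hne0
    simp only [Polynomial.eval_C] at hlim
    exact hne0 (by rw [tendsto_nhds_unique tendsto_const_nhds hlim, map_zero])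

/-! ### The variable κ = z^(1/2) and expansions in half-integer powers of z. -/

theorem norm_root (z : ℂ) : ‖root z‖ = ‖z‖ ^ (1 / 2 : ℝ) := by
  have := Complex.norm_cpow_real z (1 / 2)
  rw [root, ← this]
  norm_num

theorem root_sq (z : ℂ) : root z ^ 2 = z := by
  rw [root, ← Complex.cpow_mul_nat]
  norm_num

theorem norm_root_sq (z : ℂ) : ‖root z‖ ^ 2 = ‖z‖ := by
  rw [← norm_pow, root_sq]

theorem tendsto_root : Tendsto root (𝓝 0) (𝓝 0) := by
  rw [tendsto_zero_iff_norm_tendsto_zero]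
  simp_rw [norm_root]
  have : Tendsto (fun z : ℂ => ‖z‖ ^ (1 / 2 : ℝ)) (𝓝 0) (𝓝 (‖(0 : ℂ)‖ ^ (1 / 2 : ℝ))) :=
    (continuous_norm.rpow_const (fun _ => Or.inr (by norm_num))).tendsto 0
  simpa using this

theorem root_pow (z : ℂ) (k : ℕ) : root z ^ k = z ^ (((k : ℝ) / 2 : ℝ) : ℂ) := by
  rw [root, ← Complex.cpow_mul_nat]
  push_cast
  ring_nf

/-- The Taylor coefficients at the origin. -/
noncomputable def taylorCoeff (g : ℂ → ℂ) (n : ℕ) : ℂ := iteratedDeriv n g 0 / n.factorial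

theorem hasFPowerSeriesAt_taylorCoeff {g : ℂ → ℂ} (hg : AnalyticAt ℂ g 0) :
    HasFPowerSeriesAt g (FormalMultilinearSeries.ofScalars ℂ (taylorCoeff g)) 0 :=
  hg.hasFPowerSeriesAt

theorem hasSum_taylorCoeff {g : ℂ → ℂ} (hg : AnalyticAt ℂ g 0) :
    ∀ᶠ z in 𝓝 (0 : ℂ), HasSum (fun n : ℕ => taylorCoeff g n * (z - 0) ^ n) (g z) := by
  filter_upwards [hasFPowerSeriesAt_iff.1 (hasFPowerSeriesAt_taylorCoeff hg)] with z hz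
  simpa [FormalMultilinearSeries.coeff_ofScalars, mul_comm] using hz

theorem isBigO_sub_taylor {g : ℂ → ℂ} (hg : AnalyticAt ℂ g 0) (K : ℕ) :
    (fun z => g z - ∑ n ∈ Finset.range K, taylorCoeff g n * z ^ n) =O[𝓝 0] fun z => ‖z‖ ^ K := by
  refine ((hasFPowerSeriesAt_taylorCoeff hg).isBigO_sub_partialSum_pow K).congr_left fun z => ?_
  simp [FormalMultilinearSeries.partialSum, mul_comm]

theorem taylorCoeff_even_of_odd {g : ℂ → ℂ} (hg : ∀ᶠ z in 𝓝 0, g (-z) = -g z) (n : ℕ) :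
    taylorCoeff g (2 * n) = 0 := by
  have h1 := iteratedDeriv_comp_neg (2 * n) g 0
  rw [EventuallyEq.iteratedDeriv_eq (f := fun z => g (-z)) (g := fun z => -g z) (2 * n) hg] at h1
  rw [iteratedDeriv_fun_neg] at h1
  simp at h1
  have : iteratedDeriv (2 * n) g 0 = 0 := by linear_combination -(1/2 : ℂ) * h1
  simp [taylorCoeff, this]

/-- The coefficients, in powers of `z ^ (1 / 2)`, of `g z + Ψ (root z)`. -/
noncomputable def halfCoeff (g Ψ : ℂ → ℂ) (k : ℕ) : ℂ :=
  (if Even k then taylorCoeff g (k / 2) else 0) + taylorCoeff Ψ k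

theorem sum_halfCoeff (g Ψ : ℂ → ℂ) (K : ℕ) (z : ℂ) :
    ∑ k ∈ Finset.range (2 * K), halfCoeff g Ψ k * root z ^ k
      = ∑ n ∈ Finset.range K, taylorCoeff g n * z ^ n
        + ∑ k ∈ Finset.range (2 * K), taylorCoeff Ψ k * root z ^ k := by
  simp_rw [halfCoeff, add_mul, Finset.sum_add_distrib]
  congr 1
  induction K with
  | zero => simp
  | succ K ih =>
    rw [Nat.mul_succ, Finset.sum_range_succ, Finset.sum_range_succ, ih, Finset.sum_range_succ]
    simp [pow_mul, root_sq]

/-- The transseries coefficients of `g z + Ψ (root z)`. -/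
noncomputable def halfTransseries (g Ψ : ℂ → ℂ) (α : ℝ) : Polynomial ℂ :=
  open Classical in
  if h : ∃ k : ℕ, α = k / 2 then Polynomial.C (halfCoeff g Ψ h.choose) else 0

theorem halfTransseries_half (g Ψ : ℂ → ℂ) (k : ℕ) :
    halfTransseries g Ψ ((k : ℝ) / 2) = Polynomial.C (halfCoeff g Ψ k) := by
  have h : ∃ l : ℕ, (k : ℝ) / 2 = l / 2 := ⟨k, rfl⟩
  rw [halfTransseries, dif_pos h]
  have h2 := h.choose_spec
  have : h.choose = k := by
    have : (h.choose : ℝ) = k := by linarith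
    exact_mod_cast this
  rw [this]

/-- The power z ^ n is the even power 2n of the root, and an odd `Ψ` has no even Taylor
coefficients. -/
theorem coeff_halfTransseries_natCast {g Ψ : ℂ → ℂ} (hΨ : ∀ᶠ z in 𝓝 0, Ψ (-z) = -Ψ z)
    (n : ℕ) : (halfTransseries g Ψ (n : ℝ)).coeff 0 = taylorCoeff g n := by
  have : (n : ℝ) = ((2 * n : ℕ) : ℝ) / 2 := by push_cast; ring
  rw [this, halfTransseries_half, Polynomial.coeff_C_zero, halfCoeff, taylorCoeff_even_of_odd hΨ]
  simp

theorem isLittleO_rpow_of_lt {S : Set ℂ} {N M : ℝ} (h : N < M) :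
    (fun z : ℂ => ‖z‖ ^ M) =o[𝓝[S \ {0}] 0] (fun z : ℂ => ‖z‖ ^ N) := by
  have h0 : Tendsto (fun z : ℂ => ‖z‖ ^ (M - N)) (𝓝[S \ {0}] 0) (𝓝 0) := by
    have : Tendsto (fun z : ℂ => ‖z‖ ^ (M - N)) (𝓝 0) (𝓝 (‖(0 : ℂ)‖ ^ (M - N))) :=
      (continuous_norm.rpow_const (fun _ => Or.inr (by linarith))).tendsto 0
    rw [norm_zero, Real.zero_rpow (by linarith)] at this
    exact this.mono_left nhdsWithin_le_nhds
  have h1 : (fun z : ℂ => ‖z‖ ^ (M - N) * ‖z‖ ^ N) =o[𝓝[S \ {0}] 0]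
      (fun z : ℂ => 1 * ‖z‖ ^ N) :=
    ((isLittleO_one_iff ℝ).2 h0).mul_isBigO (isBigO_refl _ _)
  refine h1.congr' ?_ (by simp)
  filter_upwards [self_mem_nhdsWithin] with z hz
  rw [← Real.rpow_add (norm_pos_iff.2 hz.2)]
  ring_nf

/-- Both Taylor series are truncated at the same order in z, beyond N. The finitely many surplus
terms of exponent k/2 > N are themselves o(‖z‖ ^ N), so they may be moved to the remainder. -/
theorem hasTransseries_of_isBigO {f g Ψ : ℂ → ℂ} {D : Set ℂ} (hg : AnalyticAt ℂ g 0)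
    (hΨ : AnalyticAt ℂ Ψ 0)
    (hf : ∀ N : ℕ, (fun z => f z - g z - Ψ (root z)) =O[𝓝[D \ {0}] 0] (fun z => ‖z‖ ^ N)) :
    HasTransseries f D 0 (halfTransseries g Ψ) := by
  classical
  intro N
  obtain ⟨K, hK⟩ := exists_nat_gt N
  have hsmall : (fun z : ℂ => ‖z‖ ^ K) =o[𝓝[D \ {0}] 0] (fun z : ℂ => ‖z‖ ^ N) := by
    simpa using isLittleO_rpow_of_lt (S := D) hK
  -- Since N < K, all half-integers k/2 ≤ N have k < 2K.
  refine ⟨((Finset.range (2 * K)).image (fun k : ℕ => (k : ℝ) / 2)).filter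
    (fun α => α ≤ N ∧ halfTransseries g Ψ α ≠ 0), fun α => ?_, ?_⟩
  · rw [Finset.mem_filter, and_iff_right_iff_imp]
    rintro ⟨h1, h2⟩
    have h3 : ∃ k : ℕ, α = k / 2 := by
      by_contra h
      exact h2 (dif_neg h)
    obtain ⟨k, rfl⟩ := h3
    refine Finset.mem_image.2 ⟨k, Finset.mem_range.2 ?_, rfl⟩
    have : (k : ℝ) < 2 * K := by linarith
    exact_mod_cast this
  · have hinj : Set.InjOn (fun k : ℕ => (k : ℝ) / 2) (Finset.range (2 * K)) := by
      intro k _ l _ h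
      have : (k : ℝ) = l := by simpa using h
      exact_mod_cast this
    have hsum : ∀ z : ℂ, ∑ α ∈ ((Finset.range (2 * K)).image (fun k : ℕ => (k : ℝ) / 2)).filter
        (fun α => α ≤ N ∧ halfTransseries g Ψ α ≠ 0),
          (halfTransseries g Ψ α).eval (Complex.log (z - 0)) * (z - 0) ^ (α : ℂ)
        = ∑ k ∈ Finset.range (2 * K), halfCoeff g Ψ k * root z ^ k
          - ∑ k ∈ (Finset.range (2 * K)).filter (fun k : ℕ => N < (k : ℝ) / 2),
              halfCoeff g Ψ k * root z ^ k := by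
      intro z
      rw [Finset.sum_filter, Finset.sum_image hinj, Finset.sum_filter, ← Finset.sum_sub_distrib]
      refine Finset.sum_congr rfl fun k _ => ?_
      rw [halfTransseries_half, Polynomial.eval_C, sub_zero, root_pow]
      by_cases h1 : (k : ℝ) / 2 ≤ N
      · by_cases h2 : halfCoeff g Ψ k = 0
        · simp [h2]
        · simp [h1, h2, not_lt.2 h1]
      · simp [h1, not_le.1 h1]
    simp_rw [hsum, sum_halfCoeff]
    have o1 := (hf K).trans_isLittleO hsmall
    have o2 := (((isBigO_sub_taylor hg K).mono nhdsWithin_le_nhds).trans_isLittleO hsmall)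
    have o3 : (fun z => Ψ (root z) - ∑ k ∈ Finset.range (2 * K), taylorCoeff Ψ k * root z ^ k)
        =o[𝓝[D \ {0}] 0] (fun z : ℂ => ‖z‖ ^ N) := by
      have := ((isBigO_sub_taylor hΨ (2 * K)).comp_tendsto
        (tendsto_root.mono_left (nhdsWithin_le_nhds (s := D \ {0}))))
      refine IsBigO.trans_isLittleO (this.congr_right fun z => ?_) hsmall
      simp [pow_mul, norm_root_sq]
    have o4 : (fun z => ∑ k ∈ (Finset.range (2 * K)).filter (fun k : ℕ => N < (k : ℝ) / 2),
              halfCoeff g Ψ k * root z ^ k) =o[𝓝[D \ {0}] 0] (fun z : ℂ => ‖z‖ ^ N) := by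
      refine IsLittleO.fun_sum fun k hk => ?_
      have hk' : N < (k : ℝ) / 2 := (Finset.mem_filter.1 hk).2
      have hO : (fun z => root z ^ k) =O[𝓝[D \ {0}] 0] (fun z : ℂ => ‖z‖ ^ ((k : ℝ) / 2)) :=
        IsBigO.of_norm_le fun z => by rw [root_pow, Complex.norm_cpow_real]
      exact (hO.trans_isLittleO (isLittleO_rpow_of_lt hk')).const_mul_left _
    refine (((o1.add o2).add o3).add o4).congr (fun z => by ring) (fun z => by simp)

/-- Every piece of a cover accumulates at 0 and inherits the expansion `a`, so by uniqueness all
pieces have the same coefficients and none is dropped. Existence uses the cover by `D` alone. -/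
theorem isDistillate_iff_of_hasTransseries {f g : ℂ → ℂ} {D : Set ℂ} {a : ℝ → Polynomial ℂ}
    (hD : (0 : ℂ) ∈ closure (D \ {0})) (ha : HasTransseries f D 0 a) (hg : AnalyticAt ℂ g 0)
    (hag : ∀ n : ℕ, (a n).coeff 0 = taylorCoeff g n) (g' : ℂ → ℂ) :
    IsDistillate f D 0 g' ↔ g' =ᶠ[𝓝 0] g := by
  constructor
  · rintro ⟨-, 𝒟, b, c, hcover, hb, hc, hsum⟩
    have hab : ∀ S ∈ 𝒟, b S = a := fun S hS =>
      (hb S hS).2.unique (ha.mono (hcover ▸ Set.subset_sUnion_of_mem hS)) (hb S hS).1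
    -- An empty cover would make every `c` admissible, but it would force `D` to be empty.
    have hne : 𝒟.Nonempty := by
      rw [Set.nonempty_iff_ne_empty]
      rintro rfl
      simp [← hcover] at hD
    obtain ⟨S₀, hS₀⟩ := hne
    have hc' : ∀ n, c n = taylorCoeff g n := by
      intro n
      rw [← hag]
      rcases hc n with h | ⟨-, S, hS, S', hS', h⟩
      · rw [← h S₀ hS₀, hab S₀ hS₀]
      · exact absurd (by rw [hab S hS, hab S' hS']) h
    filter_upwards [hsum, hasSum_taylorCoeff hg] with z h1 h2
    simp_rw [hc'] at h1
    exact h1.unique h2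
  · intro h
    refine ⟨closure_mono Set.sdiff_subset hD, {D}, fun _ => a, taylorCoeff g, by simp, ?_, ?_, ?_⟩
    · rintro S rfl
      exact ⟨hD, ha⟩
    · exact fun n => Or.inl fun _ _ => hag n
    · filter_upwards [h, hasSum_taylorCoeff hg] with z h1 h2
      rwa [h1]

end AdSDistillate

namespace AdSDistillate

/-! ### Geometry -/

/-- The squared norm `1 + κ² r²` of the Killing vector. -/
noncomputable def lapse (k2 : ℂ) (x : Fin 4 → ℝ) : ℂ := 1 + k2 * (x 1 : ℂ) ^ 2

theorem lapse_ofReal_sq_ne_zero (κ : ℝ) (x : Fin 4 → ℝ) : lapse ((κ : ℂ) ^ 2) x ≠ 0 := by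
  have : lapse ((κ : ℂ) ^ 2) x = ((1 + κ ^ 2 * x 1 ^ 2 : ℝ) : ℂ) := by simp [lapse]
  rw [this]
  exact_mod_cast (by positivity : 1 + κ ^ 2 * x 1 ^ 2 ≠ 0)

theorem sin_ne_zero_of_mem_chart {x : Fin 4 → ℝ} (hx : x ∈ chart) : Real.sin (x 2) ≠ 0 :=
  (Real.sin_pos_of_pos_of_lt_pi hx.2.1 hx.2.2).ne'

theorem metric_eq_lapse (k2 : ℂ) (x : Fin 4 → ℝ) :
    metric k2 x = Matrix.diagonal ![lapse k2 x, -(lapse k2 x)⁻¹,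
      -(x 1 : ℂ) ^ 2, -((x 1 : ℂ) ^ 2 * (Real.sin (x 2) : ℂ) ^ 2)] := rfl

theorem metric_inv {k2 : ℂ} {x : Fin 4 → ℝ} (h : lapse k2 x ≠ 0) (h1 : x 1 ≠ 0)
    (h2 : Real.sin (x 2) ≠ 0) :
    (metric k2 x)⁻¹ = Matrix.diagonal ![(lapse k2 x)⁻¹, -lapse k2 x,
      -((x 1 : ℂ) ^ 2)⁻¹, -((x 1 : ℂ) ^ 2 * (Real.sin (x 2) : ℂ) ^ 2)⁻¹] := by
  apply Matrix.inv_eq_right_inv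
  have h1' : (x 1 : ℂ) ≠ 0 := by exact_mod_cast h1
  have h2' : (Real.sin (x 2) : ℂ) ≠ 0 := by exact_mod_cast h2
  rw [metric_eq_lapse, Matrix.diagonal_mul_diagonal, ← Matrix.diagonal_one]
  congr 1
  funext i
  fin_cases i <;> simp [h, h1', -Complex.ofReal_sin]
  field_simp

theorem velocityUp_eq (k2 : ℂ) (x : Fin 4 → ℝ) (μ : Fin 4) :
    velocityUp k2 x μ = if μ = 0 then 1 / lapse k2 x ^ (1 / 2 : ℂ) else 0 := by
  rw [velocityUp]
  fin_cases μ <;> simp [Fin.sum_univ_four, killing, metric_eq_lapse]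

theorem velocity_eq (k2 : ℂ) (x : Fin 4 → ℝ) (μ : Fin 4) :
    velocity k2 x μ = if μ = 0 then lapse k2 x / lapse k2 x ^ (1 / 2 : ℂ) else 0 := by
  rw [velocity]
  simp_rw [velocityUp_eq]
  fin_cases μ <;> simp [metric_eq_lapse, div_eq_mul_inv]

theorem cpow_half_mul_self (z : ℂ) : z ^ (1 / 2 : ℂ) * z ^ (1 / 2 : ℂ) = z := by
  rw [← sq]
  exact root_sq z

/-- The square root of the lapse occurs twice, so the branch drops out and the product is polynomial
in κ². -/
theorem velocity_mul_velocity (k2 : ℂ) (x : Fin 4 → ℝ) (μ ν : Fin 4) :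
    velocity k2 x μ * velocity k2 x ν = if μ = 0 ∧ ν = 0 then lapse k2 x else 0 := by
  rw [velocity_eq, velocity_eq]
  by_cases hμ : μ = 0 <;> by_cases hν : ν = 0 <;> simp only [hμ, hν, if_true, if_false, true_and,
    false_and, and_false, mul_zero, zero_mul]
  rw [div_mul_div_comm, cpow_half_mul_self, mul_self_div_self]

theorem radiationTensor_eq (k2 : ℂ) (x : Fin 4 → ℝ) (μ ν : Fin 4) :
    radiationTensor k2 x μ ν = Matrix.diagonal ![3 * lapse k2 x, (lapse k2 x)⁻¹,
      (x 1 : ℂ) ^ 2, (x 1 : ℂ) ^ 2 * (Real.sin (x 2) : ℂ) ^ 2] μ ν := by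
  rw [radiationTensor, mul_assoc, velocity_mul_velocity, metric_eq_lapse]
  fin_cases μ <;> fin_cases ν <;> simp [-Complex.ofReal_sin]
  ring

/-- The partial derivatives of the diagonal entries of the metric. -/
noncomputable def metricDeriv (k2 : ℂ) (x : Fin 4 → ℝ) : Fin 4 → Fin 4 → ℂ :=
  ![0, ![2 * k2 * x 1, 2 * k2 * x 1 / lapse k2 x ^ 2, -2 * x 1,
      -2 * x 1 * (Real.sin (x 2) : ℂ) ^ 2],
    ![0, 0, 0, -2 * (x 1 : ℂ) ^ 2 * Real.sin (x 2) * Real.cos (x 2)], 0]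

theorem hasDerivAt_ofReal_sq (r : ℝ) :
    HasDerivAt (fun s : ℝ => (s : ℂ) ^ 2) (2 * r) r := by
  have h1 : HasDerivAt (fun s : ℝ => (s : ℂ)) 1 r := Complex.ofRealCLM.hasDerivAt
  exact (h1.fun_pow 2).congr_deriv (by push_cast; ring)

theorem hasDerivAt_lapse (k2 : ℂ) (x : Fin 4 → ℝ) :
    HasDerivAt (fun s : ℝ => 1 + k2 * (s : ℂ) ^ 2) (2 * k2 * x 1) (x 1) :=
  (((hasDerivAt_ofReal_sq (x 1)).const_mul k2).const_add 1).congr_deriv (by ring)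

theorem deriv_lapse_inv {k2 : ℂ} {x : Fin 4 → ℝ} (h : lapse k2 x ≠ 0) :
    deriv (fun s : ℝ => (1 + k2 * (s : ℂ) ^ 2)⁻¹) (x 1)
      = -(2 * k2 * x 1 / lapse k2 x ^ 2) := by
  rw [((hasDerivAt_lapse k2 x).fun_inv h).deriv, lapse]
  ring

theorem partialDeriv_metric {k2 : ℂ} {x : Fin 4 → ℝ} (h : lapse k2 x ≠ 0) (μ σ ν : Fin 4) :
    partialDeriv μ (fun y => metric k2 y σ ν) x = Matrix.diagonal (metricDeriv k2 x μ) σ ν := by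
  have hr := (hasDerivAt_ofReal_sq (x 1)).deriv
  have hθ : deriv (fun s : ℝ => (Real.sin s : ℂ) ^ 2) (x 2)
      = 2 * Real.sin (x 2) * Real.cos (x 2) :=
    (((Real.hasDerivAt_sin (x 2)).ofReal_comp).fun_pow 2).deriv.trans (by push_cast; ring)
  rw [partialDeriv]
  by_cases hσν : σ = ν
  · subst hσν
    simp only [metric, Matrix.diagonal_apply_eq]
    fin_cases μ <;> fin_cases σ <;>
      simp [metricDeriv, -Complex.ofReal_sin, -Complex.ofReal_cos, hr, hθ, deriv_lapse_inv h]
    all_goals ring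
  · simp [metric, Matrix.diagonal_apply_ne _ hσν]

theorem christoffel_eq {k2 : ℂ} {x : Fin 4 → ℝ} (h : lapse k2 x ≠ 0) (h1 : x 1 ≠ 0)
    (h2 : Real.sin (x 2) ≠ 0) (l μ ν : Fin 4) :
    christoffel k2 l μ ν x = (1 / 2) * ![(lapse k2 x)⁻¹, -lapse k2 x,
      -((x 1 : ℂ) ^ 2)⁻¹, -((x 1 : ℂ) ^ 2 * (Real.sin (x 2) : ℂ) ^ 2)⁻¹] l *
      (Matrix.diagonal (metricDeriv k2 x μ) l ν + Matrix.diagonal (metricDeriv k2 x ν) l μ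
        - Matrix.diagonal (metricDeriv k2 x l) μ ν) := by
  rw [christoffel, metric_inv h h1 h2, Finset.sum_eq_single l]
  · rw [Matrix.diagonal_apply_eq, partialDeriv_metric h, partialDeriv_metric h,
      partialDeriv_metric h, mul_assoc]
  · intro σ _ hσ
    rw [Matrix.diagonal_apply_ne _ hσ.symm, zero_mul]
  · simp

/-- The velocity is stationary and has only a time component, with u^t u_t = 1. Hence A_μ =
-Γ^t_{tμ}, and only the radial component survives. -/
theorem acceleration_eq {k2 : ℂ} {x : Fin 4 → ℝ} (h : lapse k2 x ≠ 0) (h1 : x 1 ≠ 0)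
    (h2 : Real.sin (x 2) ≠ 0) (μ : Fin 4) :
    acceleration k2 x μ = if μ = 1 then -(k2 * x 1 / lapse k2 x) else 0 := by
  have hu : velocityUp k2 x 0 * velocity k2 x 0 = 1 := by
    have : lapse k2 x ^ (1 / 2 : ℂ) ≠ 0 := by simp [Complex.cpow_eq_zero_iff, h]
    rw [velocityUp_eq, velocity_eq, if_pos rfl, if_pos rfl, div_mul_div_comm, cpow_half_mul_self,
      one_mul, div_self h]
  have hd : ∀ μ, partialDeriv 0 (fun y => velocity k2 y μ) x = 0 := by
    intro μ
    rw [partialDeriv]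
    simp [velocity_eq, lapse]
  have e : acceleration k2 x μ = -christoffel k2 0 0 μ x := by
    rw [acceleration, Finset.sum_eq_single 0, hd, Finset.sum_eq_single 0]
    · linear_combination (-christoffel k2 0 0 μ x) * hu
    · intro l _ hl
      rw [velocity_eq, if_neg hl, mul_zero]
    · simp
    · intro ν _ hν
      rw [velocityUp_eq, if_neg hν, zero_mul]
    · simp
  rw [e, christoffel_eq h h1 h2]
  fin_cases μ <;> simp [metricDeriv]
  field_simp

/-! ### Trace, divergence and zeros of the distilled tensor. -/

theorem traceTensor_distilledTensor (T₀ : ℝ) {k2 : ℂ} {x : Fin 4 → ℝ} (h : lapse k2 x ≠ 0)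
    (h1 : x 1 ≠ 0) (h2 : Real.sin (x 2) ≠ 0) :
    traceTensor k2 (distilledTensor T₀ k2) x = 0 := by
  have h1' : (x 1 : ℂ) ≠ 0 := by exact_mod_cast h1
  have h2' : (Real.sin (x 2) : ℂ) ≠ 0 := by exact_mod_cast h2
  rw [traceTensor, metric_inv h h1 h2]
  simp_rw [distilledTensor, radiationTensor_eq]
  simp [Fin.sum_univ_four, -Complex.ofReal_sin]
  field_simp
  ring

/-- The prefactor of the distilled tensor that does not depend on the point. -/
noncomputable def distilledCoeff (T₀ : ℝ) (k2 : ℂ) : ℂ :=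
  (Real.pi : ℂ) ^ 2 / 90 * (T₀ : ℂ) ^ 4 - k2 ^ 2 / (1440 * (Real.pi : ℂ) ^ 2)

theorem raiseTensor_distilledTensor (T₀ : ℝ) {k2 : ℂ} {x : Fin 4 → ℝ} (h : lapse k2 x ≠ 0)
    (h1 : x 1 ≠ 0) (h2 : Real.sin (x 2) ≠ 0) (μ ν : Fin 4) :
    raiseTensor k2 (distilledTensor T₀ k2) x μ ν =
      distilledCoeff T₀ k2 * Matrix.diagonal ![3 * ((lapse k2 x)⁻¹) ^ 3, (lapse k2 x)⁻¹,
        ((lapse k2 x)⁻¹) ^ 2 * ((x 1 : ℂ) ^ 2)⁻¹,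
        ((lapse k2 x)⁻¹) ^ 2 * ((x 1 : ℂ) ^ 2 * (Real.sin (x 2) : ℂ) ^ 2)⁻¹] μ ν := by
  have h1' : (x 1 : ℂ) ≠ 0 := by exact_mod_cast h1
  have h2' : (Real.sin (x 2) : ℂ) ≠ 0 := by exact_mod_cast h2
  have hl : 1 + k2 * (x 1 : ℂ) ^ 2 = lapse k2 x := rfl
  rw [raiseTensor, metric_inv h h1 h2]
  simp_rw [distilledTensor, radiationTensor_eq, hl]
  rw [Finset.sum_eq_single μ, Finset.sum_eq_single ν]
  · rw [Matrix.diagonal_apply_eq, Matrix.diagonal_apply_eq, distilledCoeff]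
    by_cases hμν : μ = ν
    · subst hμν
      rw [Matrix.diagonal_apply_eq, Matrix.diagonal_apply_eq]
      fin_cases μ <;> simp [-Complex.ofReal_sin] <;> field_simp
    · rw [Matrix.diagonal_apply_ne _ hμν, Matrix.diagonal_apply_ne _ hμν]
      ring
  · intro β _ hβ
    rw [Matrix.diagonal_apply_ne _ hβ.symm]
    ring
  · simp
  · intro α _ hα
    rw [Matrix.diagonal_apply_ne _ hα.symm]
    simp
  · simp

theorem divergence_distilledTensor (T₀ κ : ℝ) {x : Fin 4 → ℝ} (hx : x ∈ chart) (ν : Fin 4) :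
    divergence ((κ : ℂ) ^ 2) (distilledTensor T₀ ((κ : ℂ) ^ 2)) x ν = 0 := by
  set k2 : ℂ := (κ : ℂ) ^ 2 with hk2
  have h : ∀ y, lapse k2 y ≠ 0 := fun y => lapse_ofReal_sq_ne_zero κ y
  have h1 : x 1 ≠ 0 := hx.1.ne'
  have h2 := sin_ne_zero_of_mem_chart hx
  have h1' : (x 1 : ℂ) ≠ 0 := by exact_mod_cast h1
  have h2' : (Real.sin (x 2) : ℂ) ≠ 0 := by exact_mod_cast h2
  -- The closed form of the raised tensor needs r ≠ 0 and sin θ ≠ 0. Differentiating it requires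
  -- these along a whole interval of each coordinate line.
  have hev : ∀ μ : Fin 4, ∀ᶠ s : ℝ in 𝓝 (x μ),
      Function.update x μ s 1 ≠ 0 ∧ Real.sin (Function.update x μ s 2) ≠ 0 := by
    intro μ
    have hc : Continuous fun s : ℝ => Function.update x μ s :=
      continuous_const.update μ continuous_id
    have c1 : ContinuousAt (fun s : ℝ => Function.update x μ s 1) (x μ) :=
      ((continuous_apply 1).comp hc).continuousAt
    have c2 : ContinuousAt (fun s : ℝ => Real.sin (Function.update x μ s 2)) (x μ) :=
      (Real.continuous_sin.comp ((continuous_apply 2).comp hc)).continuousAt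
    exact (c1.eventually_ne (by simpa using h1)).and (c2.eventually_ne (by simpa using h2))
  have hdiff : ∀ μ, partialDeriv μ (fun y => raiseTensor k2 (distilledTensor T₀ k2) y μ ν) x =
      distilledCoeff T₀ k2 * if μ = ν then
        (if μ = 1 then -(2 * k2 * x 1 / lapse k2 x ^ 2) else 0) else 0 := by
    intro μ
    rw [partialDeriv, EventuallyEq.deriv_eq ((hev μ).mono fun s hs =>
      raiseTensor_distilledTensor T₀ (h _) hs.1 hs.2 μ ν)]
    by_cases hμν : μ = ν
    · subst hμν
      simp only [Matrix.diagonal_apply_eq]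
      have hl := deriv_lapse_inv (h x)
      fin_cases μ <;> simp [lapse, -Complex.ofReal_sin] at hl ⊢
      rw [hl]
      ring
    · simp [hμν]
  rw [divergence]
  simp_rw [hdiff, christoffel_eq (h x) h1 h2, raiseTensor_distilledTensor T₀ (h x) h1 h2]
  have hr : k2 * (x 1 : ℂ) ^ 2 = lapse k2 x - 1 := by simp [lapse]
  have hx' := h x
  fin_cases ν <;> simp [Fin.sum_univ_four, metricDeriv, -Complex.ofReal_sin, -Complex.ofReal_cos]
  · field_simp
    ring_nf
  · field_simp
    ring_nf

/-- The prefactor equals (π²/90)(T₀⁴ - (κ/2π)⁴), and fourth powers are injective on non-negative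
reals. The time component of the remaining tensor is 3 times the lapse, so it never vanishes. -/
theorem distilledTensor_eq_zero_iff {T₀ κ : ℝ} (hT : 0 ≤ T₀) (hκ : 0 < κ) (x : Fin 4 → ℝ) :
    (∀ μ ν : Fin 4, distilledTensor T₀ ((κ : ℂ) ^ 2) x μ ν = 0) ↔ T₀ = κ / (2 * Real.pi) := by
  have hl := lapse_ofReal_sq_ne_zero κ x
  have e : ∀ μ ν, distilledTensor T₀ ((κ : ℂ) ^ 2) x μ ν = distilledCoeff T₀ ((κ : ℂ) ^ 2)
      * (1 / lapse ((κ : ℂ) ^ 2) x) ^ 2 * radiationTensor ((κ : ℂ) ^ 2) x μ ν := fun _ _ => rfl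
  have hcoeff : distilledCoeff T₀ ((κ : ℂ) ^ 2) = 0 ↔ T₀ = κ / (2 * Real.pi) := by
    have : distilledCoeff T₀ ((κ : ℂ) ^ 2)
        = ((Real.pi ^ 2 / 90 * (T₀ ^ 4 - (κ / (2 * Real.pi)) ^ 4) : ℝ) : ℂ) := by
      rw [distilledCoeff]
      push_cast
      have : (Real.pi : ℂ) ≠ 0 := by exact_mod_cast Real.pi_ne_zero
      field_simp
      ring
    rw [this, Complex.ofReal_eq_zero, mul_eq_zero, or_iff_right (by positivity), sub_eq_zero,
      pow_left_inj₀ hT (by positivity) (by norm_num)]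
  rw [← hcoeff]
  constructor
  · intro h
    have := h 0 0
    rw [e, radiationTensor_eq] at this
    simpa [hl] using this
  · intro h μ ν
    rw [e, h]
    ring

end AdSDistillate

namespace AdSDistillate

/-! ### Lambert series and Eisenstein series -/

open Complex (exp I)
open scoped Real ModularForm MatrixGroups

/-- The Lambert series `∑_{n ≥ 1} n ^ k / (exp (n y) - 1)`. -/
noncomputable def lambert (k : ℕ) (y : ℂ) : ℂ :=
  ∑' n : ℕ, ((n : ℂ) + 1) ^ k / (exp (((n : ℂ) + 1) * y) - 1)

theorem f3_eq_lambert (y : ℂ) : f3 y = lambert 3 y := rfl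

/-- With x = Re y, the denominator is at least e^{(n+1)x} - 1, and 1 ≤ e^{(n+1)x} e^{-x} absorbs the
1 into a factor independent of n. -/
theorem norm_inv_exp_sub_one_le {y : ℂ} (hy : 0 < y.re) (n : ℕ) :
    ‖(exp (((n : ℂ) + 1) * y) - 1)⁻¹‖
      ≤ (1 - Real.exp (-y.re))⁻¹ * Real.exp (-(((n : ℝ) + 1) * y.re)) := by
  have h1 : Real.exp (-y.re) < 1 := by simpa using hy
  have h2 : Real.exp (((n : ℝ) + 1) * y.re) * (1 - Real.exp (-y.re))
      ≤ ‖exp (((n : ℂ) + 1) * y) - 1‖ := by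
    have h3 : ‖exp (((n : ℂ) + 1) * y)‖ = Real.exp (((n : ℝ) + 1) * y.re) := by
      rw [Complex.norm_exp]
      simp
    have h4 := norm_sub_norm_le (exp (((n : ℂ) + 1) * y)) 1
    rw [h3, norm_one] at h4
    have h5 : 1 ≤ Real.exp (((n : ℝ) + 1) * y.re) * Real.exp (-y.re) := by
      rw [← Real.exp_add, Real.one_le_exp_iff]
      have : 0 ≤ (n : ℝ) * y.re := by positivity
      linarith
    linarith
  have h6 : 0 < Real.exp (((n : ℝ) + 1) * y.re) * (1 - Real.exp (-y.re)) :=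
    mul_pos (Real.exp_pos _) (by linarith)
  rw [norm_inv]
  refine (inv_anti₀ h6 h2).trans_eq ?_
  rw [mul_inv, Real.exp_neg (((n : ℝ) + 1) * y.re)]
  ring

theorem summable_pow_mul_exp_neg (k : ℕ) {c : ℝ} (hc : 0 < c) :
    Summable fun n : ℕ => ((n : ℝ) + 1) ^ k * Real.exp (-(((n : ℝ) + 1) * c)) := by
  have h := Real.summable_pow_mul_exp_neg_nat_mul k hc
  refine ((summable_nat_add_iff 1).2 h).congr fun n => ?_
  push_cast
  ring_nf

theorem summable_lambert (k : ℕ) {y : ℂ} (hy : 0 < y.re) :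
    Summable fun n : ℕ => ((n : ℂ) + 1) ^ k / (exp (((n : ℂ) + 1) * y) - 1) := by
  refine Summable.of_norm_bounded ((summable_pow_mul_exp_neg k hy).mul_left
    (1 - Real.exp (-y.re))⁻¹) fun n => ?_
  rw [div_eq_mul_inv, norm_mul, norm_pow]
  have h1 : ‖(n : ℂ) + 1‖ = (n : ℝ) + 1 := by exact_mod_cast Complex.norm_natCast (n + 1)
  rw [h1]
  calc ((n : ℝ) + 1) ^ k * ‖(exp (((n : ℂ) + 1) * y) - 1)⁻¹‖
      ≤ ((n : ℝ) + 1) ^ k * ((1 - Real.exp (-y.re))⁻¹ * Real.exp (-(((n : ℝ) + 1) * y.re))) := by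
        gcongr
        exact norm_inv_exp_sub_one_le hy n
    _ = _ := by ring

/-- Away from the imaginary axis the series is controlled by its first term. This makes the modular
images exponentially small. -/
theorem norm_lambert_le (k : ℕ) : ∃ K : ℝ, 0 ≤ K ∧ ∀ y : ℂ, 1 ≤ y.re →
    ‖lambert k y‖ ≤ K * Real.exp (-y.re) := by
  have hs : Summable fun n : ℕ => 2 * (((n : ℝ) + 1) ^ k * Real.exp (-(n : ℝ))) := by
    refine (((summable_pow_mul_exp_neg k one_pos).mul_left (2 * Real.exp 1))).congr fun n => ?_
    rw [show -(n : ℝ) = 1 + -(((n : ℝ) + 1) * 1) by ring, Real.exp_add]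
    ring
  refine ⟨∑' n : ℕ, 2 * (((n : ℝ) + 1) ^ k * Real.exp (-(n : ℝ))),
    tsum_nonneg fun n => by positivity, fun y hy => ?_⟩
  rw [← tsum_mul_right]
  refine tsum_of_norm_bounded (hs.mul_right _).hasSum fun n => ?_
  rw [div_eq_mul_inv, norm_mul, norm_pow]
  have h1 : ‖(n : ℂ) + 1‖ = (n : ℝ) + 1 := by exact_mod_cast Complex.norm_natCast (n + 1)
  have h2 : (1 - Real.exp (-y.re))⁻¹ ≤ 2 := by
    have h3 : Real.exp (-y.re) ≤ Real.exp (-1) := Real.exp_le_exp.2 (by linarith)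
    have h4 : Real.exp (-1) < 1 / 2 := by
      have := Real.exp_neg_one_lt_d9
      linarith
    rw [inv_le_comm₀ (by linarith) (by norm_num)]
    linarith
  have h3 : Real.exp (-(((n : ℝ) + 1) * y.re)) ≤ Real.exp (-(n : ℝ)) * Real.exp (-y.re) := by
    rw [← Real.exp_add]
    refine Real.exp_le_exp.2 ?_
    have : 0 ≤ (n : ℝ) * (y.re - 1) := mul_nonneg (by positivity) (by linarith)
    linarith
  rw [h1]
  calc ((n : ℝ) + 1) ^ k * ‖(exp (((n : ℂ) + 1) * y) - 1)⁻¹‖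
      ≤ ((n : ℝ) + 1) ^ k * (2 * (Real.exp (-(n : ℝ)) * Real.exp (-y.re))) := by
        gcongr
        exact (norm_inv_exp_sub_one_le (by linarith) n).trans (by gcongr)
    _ = _ := by ring

/-- The point `i y / 2 π` of the upper half plane. -/
noncomputable def tau (y : ℂ) (hy : 0 < y.re) : UpperHalfPlane :=
  ⟨I * y / (2 * π), by
    have : (I * y / (2 * π)).im = y.re / (2 * π) := by
      rw [show (2 * π : ℂ) = ((2 * π : ℝ) : ℂ) by push_cast; rfl, Complex.div_ofReal_im]
      simp
    rw [this]
    positivity⟩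

theorem coe_tau (y : ℂ) (hy : 0 < y.re) : (tau y hy : ℂ) = I * y / (2 * π) := rfl

theorem exp_two_pi_I_tau (y : ℂ) (hy : 0 < y.re) : exp (2 * π * I * tau y hy) = exp (-y) := by
  have hπ : (π : ℂ) ≠ 0 := by exact_mod_cast Real.pi_ne_zero
  rw [coe_tau]
  congr 1
  field_simp
  rw [Complex.I_sq]
  ring

theorem lambert_eq_sigma (k : ℕ) {y : ℂ} (hy : 0 < y.re) :
    lambert k y = ∑' n : ℕ+, (ArithmeticFunction.sigma k n : ℂ) * exp (-y) ^ (n : ℕ) := by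
  have hr : ‖exp (-y)‖ < 1 := by
    rw [Complex.norm_exp]
    simpa using hy
  rw [← tsum_pow_div_one_sub_eq_tsum_sigma hr k,
    tsum_pnat_eq_tsum_succ (f := fun n : ℕ => (n : ℂ) ^ k * exp (-y) ^ n / (1 - exp (-y) ^ n)),
    lambert]
  refine tsum_congr fun n => ?_
  rw [← Complex.exp_nat_mul, mul_neg, Complex.exp_neg]
  have h0 := Complex.exp_ne_zero (((n + 1 : ℕ) : ℂ) * y)
  push_cast at h0 ⊢
  by_cases h1 : exp (((n : ℂ) + 1) * y) - 1 = 0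
  · have : exp (((n : ℂ) + 1) * y) = 1 := sub_eq_zero.1 h1
    simp [this]
  · have h2 : 1 - (exp (((n : ℂ) + 1) * y))⁻¹ ≠ 0 := by
      intro h
      apply h1
      rw [sub_eq_zero, eq_comm, inv_eq_one] at h
      rw [h, sub_self]
    field_simp

/-! ### The inversion y ↦ 4π²/y and the modular transformations. -/

theorem re_four_pi_sq_div {y : ℂ} (hy : 0 < y.re) : 0 < (4 * π ^ 2 / y : ℂ).re := by
  have : (4 * π ^ 2 / y : ℂ).re = 4 * π ^ 2 * (y.re / Complex.normSq y) := by
    rw [show (4 * π ^ 2 / y : ℂ) = ((4 * π ^ 2 : ℝ) : ℂ) * y⁻¹ by push_cast; ring,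
      Complex.re_ofReal_mul, Complex.inv_re]
  rw [this]
  have : 0 < Complex.normSq y := Complex.normSq_pos.2 (by rintro rfl; simp at hy)
  positivity

theorem tau_four_pi_sq_div {y : ℂ} (hy : 0 < y.re) :
    tau (4 * π ^ 2 / y) (re_four_pi_sq_div hy) =
      .mk (-(tau y hy : ℂ))⁻¹ (tau y hy).im_inv_neg_coe_pos := by
  have hπ : (π : ℂ) ≠ 0 := by exact_mod_cast Real.pi_ne_zero
  have hy0 : y ≠ 0 := by rintro rfl; simp at hy
  ext
  change I * (4 * π ^ 2 / y) / (2 * π) = (-(I * y / (2 * π)))⁻¹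
  rw [← neg_div, inv_div, div_eq_div_iff (by simp [hπ]) (by simp [hy0])]
  field_simp
  rw [Complex.I_sq]
  ring

theorem E_four_tau {y : ℂ} (hy : 0 < y.re) :
    ModularForm.E (by norm_num : 3 ≤ 4) (tau y hy) = 1 + 240 * lambert 3 y := by
  rw [EisensteinSeries.q_expansion_bernoulli _ (by decide), lambert_eq_sigma 3 hy,
    exp_two_pi_I_tau]
  -- The factor 240 is -2k/B_k at k = 4.
  have hb : bernoulli 4 = -1 / 30 := by
    rw [bernoulli_eq_bernoulli'_of_ne_one (by norm_num), bernoulli'_four]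
  rw [hb]
  norm_num

theorem E_four_S_smul (z : UpperHalfPlane) :
    ModularForm.E (by norm_num : 3 ≤ 4) (.mk (-(z : ℂ))⁻¹ z.im_inv_neg_coe_pos)
      = (z : ℂ) ^ 4 * ModularForm.E (by norm_num : 3 ≤ 4) z := by
  have h1 := SlashInvariantForm.slash_S_apply
    (ModularForm.E (by norm_num : 3 ≤ 4)) 4 z
  have h2 : ((ModularForm.E (by norm_num : 3 ≤ 4) : UpperHalfPlane → ℂ)
      ∣[(4 : ℤ)] ModularGroup.S) = ModularForm.E (by norm_num : 3 ≤ 4) :=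
    SlashInvariantForm.slash_action_eqn (Γ := 𝒮ℒ) _ _ ⟨ModularGroup.S, rfl⟩
  rw [h2] at h1
  rw [h1]
  have := z.ne_zero
  simp only [Int.reduceNeg, zpow_neg]
  field_simp

/-- The modular transformation of the Lambert series of weight four. -/
theorem lambert_three {y : ℂ} (hy : 0 < y.re) :
    lambert 3 y = π ^ 4 / (15 * y ^ 4) - 1 / 240
      + 16 * π ^ 4 / y ^ 4 * lambert 3 (4 * π ^ 2 / y) := by
  have hπ : (π : ℂ) ≠ 0 := by exact_mod_cast Real.pi_ne_zero
  have hy0 : y ≠ 0 := by rintro rfl; simp at hy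
  have h := E_four_S_smul (tau y hy)
  rw [← tau_four_pi_sq_div, E_four_tau, E_four_tau, coe_tau] at h
  have hI : (I * y / (2 * π)) ^ 4 = y ^ 4 / (16 * π ^ 4) := by
    rw [div_pow, mul_pow, Complex.I_pow_four]
    ring
  rw [hI] at h
  field_simp at h ⊢
  linear_combination -15 * h

theorem E2_tau {y : ℂ} (hy : 0 < y.re) : EisensteinSeries.E2 (tau y hy) = 1 - 24 * lambert 1 y := by
  rw [EisensteinSeries.E2_eq_tsum_cexp, lambert_eq_sigma 1 hy]
  congr 3
  funext n
  congr 2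
  rw [← exp_two_pi_I_tau y hy]

/-- The modular transformation of the Lambert series of weight two. -/
theorem lambert_one {y : ℂ} (hy : 0 < y.re) :
    lambert 1 y = π ^ 2 / (6 * y ^ 2) - 1 / (2 * y) + 1 / 24
      - 4 * π ^ 2 / y ^ 2 * lambert 1 (4 * π ^ 2 / y) := by
  have hπ : (π : ℂ) ≠ 0 := by exact_mod_cast Real.pi_ne_zero
  have hy0 : y ≠ 0 := by rintro rfl; simp at hy
  -- `E2` is only quasimodular; its anomaly `D2` is the source of the term 1/(2y).
  have h := congrFun (EisensteinSeries.E2_slash_action ModularGroup.S) (tau y hy)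
  rw [SlashInvariantForm.slash_S_apply, ← tau_four_pi_sq_div, Pi.sub_apply, Pi.smul_apply,
    EisensteinSeries.D2_S, E2_tau, E2_tau, coe_tau, riemannZeta_two] at h
  simp only [smul_eq_mul, Int.reduceNeg, zpow_neg] at h
  norm_cast at h
  push_cast at h
  rw [div_pow, mul_pow, Complex.I_sq] at h
  field_simp at h ⊢
  linear_combination 12 * h

/-- Write (-1)ⁿ = (1 + (-1)ⁿ) - 1. The first part keeps only even indices n = 2m, where the weight 2
and the numerator 2m give the factor 4. With the index shifted by one, even n are the odd positions
of the sum. -/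
theorem tsum_neg_one_pow_lambert_one {w : ℂ} (hw : 0 < w.re) :
    ∑' n : ℕ, ((n : ℂ) + 1) * (-1) ^ (n + 1) / (exp (((n : ℂ) + 1) * w) - 1)
      = 4 * lambert 1 (2 * w) - lambert 1 w := by
  have hw2 : 0 < (2 * w).re := by simpa using hw
  have h1 : HasSum (fun n : ℕ => ((n : ℂ) + 1) ^ 1 / (exp (((n : ℂ) + 1) * w) - 1))
      (lambert 1 w) := (summable_lambert 1 hw).hasSum
  have h2 : HasSum (fun n : ℕ => (1 + (-1) ^ (n + 1)) *
      (((n : ℂ) + 1) ^ 1 / (exp (((n : ℂ) + 1) * w) - 1))) (0 + 4 * lambert 1 (2 * w)) := by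
    refine HasSum.even_add_odd ?_ ?_
    · convert hasSum_zero using 2 with n
      simp [pow_succ, pow_mul]
    · refine ((summable_lambert 1 hw2).hasSum.mul_left 4).congr_fun fun n => ?_
      have e : (((2 * n + 1 : ℕ) : ℂ) + 1) * w = ((n : ℂ) + 1) * (2 * w) := by
        push_cast
        ring
      rw [e, show (-1 : ℂ) ^ (2 * n + 1 + 1) = 1 by
        rw [show 2 * n + 1 + 1 = 2 * (n + 1) by ring, pow_mul]; simp]
      push_cast
      ring
  have h3 := h2.sub h1
  rw [zero_add] at h3
  refine (h3.congr_fun fun n => ?_).tsum_eq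
  ring

/-- The alternating combination removes the double pole: 4 · π²/(6(2w)²) cancels π²/(6w²). -/
theorem tsum_neg_one_pow_lambert_one_eq {w : ℂ} (hw : 0 < w.re) :
    ∑' n : ℕ, ((n : ℂ) + 1) * (-1) ^ (n + 1) / (exp (((n : ℂ) + 1) * w) - 1)
      = -(1 / (2 * w)) + 1 / 8
        - 4 * π ^ 2 / w ^ 2 * (lambert 1 (2 * π ^ 2 / w) - lambert 1 (4 * π ^ 2 / w)) := by
  have hw0 : w ≠ 0 := by rintro rfl; simp at hw
  have hw2 : 0 < (2 * w).re := by simpa using hw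
  have e : (4 * π ^ 2 / (2 * w) : ℂ) = 2 * π ^ 2 / w := by
    field_simp
    ring
  rw [tsum_neg_one_pow_lambert_one hw, lambert_one hw2, lambert_one hw, e]
  field_simp
  ring

end AdSDistillate

namespace AdSDistillate

/-! ### The series `∑ (-1)ⁿ n² sin (2 n a) / (exp (n w) - 1)` as a lattice sum -/

open Complex (exp I)
open scoped Real

/-- The series `∑_{n ≥ 1} (-1) ^ n n ^ m sin (2 n a) / (exp (n w) - 1)`. -/
noncomputable def sinSum (m : ℕ) (w a : ℂ) : ℂ :=
  ∑' n : ℕ, ((n : ℂ) + 1) ^ m * (-1) ^ (n + 1) / (exp (((n : ℂ) + 1) * w) - 1)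
    * Complex.sin (2 * ((n : ℂ) + 1) * a)

/-- The series `∑_{n ≥ 1} (-1) ^ n n ^ m cos (2 n a) / (exp (n w) - 1)`. -/
noncomputable def cosSum (m : ℕ) (w a : ℂ) : ℂ :=
  ∑' n : ℕ, ((n : ℂ) + 1) ^ m * (-1) ^ (n + 1) / (exp (((n : ℂ) + 1) * w) - 1)
    * Complex.cos (2 * ((n : ℂ) + 1) * a)

theorem norm_sin_le_exp_abs_im (z : ℂ) : ‖Complex.sin z‖ ≤ Real.exp |z.im| := by
  have h1 : ‖exp (-z * I)‖ ≤ Real.exp |z.im| := by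
    rw [Complex.norm_exp]
    exact Real.exp_le_exp.2 (by simpa using le_abs_self z.im)
  have h2 : ‖exp (z * I)‖ ≤ Real.exp |z.im| := by
    rw [Complex.norm_exp]
    exact Real.exp_le_exp.2 (by simpa using neg_le_abs z.im)
  rw [Complex.sin, norm_div, norm_mul, Complex.norm_I, mul_one, Complex.norm_ofNat]
  have := norm_sub_le (exp (-z * I)) (exp (z * I))
  linarith

theorem norm_cos_le_exp_abs_im (z : ℂ) : ‖Complex.cos z‖ ≤ Real.exp |z.im| := by
  rw [← Complex.sin_add_pi_div_two]
  refine (norm_sin_le_exp_abs_im _).trans_eq ?_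
  rw [show (z + π / 2 : ℂ) = z + ((π / 2 : ℝ) : ℂ) by push_cast; rfl, Complex.add_im,
    Complex.ofReal_im, add_zero]

theorem abs_im_two_mul_natCast_mul (n : ℕ) (a : ℂ) :
    |(2 * ((n : ℂ) + 1) * a).im| = ((n : ℝ) + 1) * (2 * |a.im|) := by
  have : (2 * ((n : ℂ) + 1) * a).im = ((n : ℝ) + 1) * (2 * a.im) := by
    rw [show (2 * ((n : ℂ) + 1) * a) = ((((n : ℝ) + 1) * 2 : ℝ) : ℂ) * a by push_cast; ring,
      Complex.im_ofReal_mul]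
    ring
  rw [this, abs_mul, abs_mul, abs_two, abs_of_nonneg (by positivity : 0 ≤ (n : ℝ) + 1)]

/-- The sum `∑_m (z + m)⁻³` of Lipschitz. -/
noncomputable def lipschitzSum (z : ℂ) : ℂ := ∑' m : ℤ, 1 / (z + m) ^ 3

theorem lipschitzSum_neg (z : ℂ) : lipschitzSum (-z) = -lipschitzSum z := by
  rw [lipschitzSum, lipschitzSum, ← tsum_neg, ← (Equiv.neg ℤ).tsum_eq]
  refine tsum_congr fun m => ?_
  rw [Equiv.neg_apply, Int.cast_neg, ← neg_add, Odd.neg_pow (by decide), div_neg]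

theorem lipschitzSum_one_add (z : ℂ) : lipschitzSum (1 + z) = lipschitzSum z := by
  rw [lipschitzSum, lipschitzSum, ← (Equiv.addRight (1 : ℤ)).tsum_eq (fun m : ℤ => 1 / (z + m) ^ 3)]
  refine tsum_congr fun m => ?_
  rw [Equiv.coe_addRight]
  push_cast
  ring_nf

/-- Periodicity and oddness together reflect a point of the lower half plane into the upper one,
where the q-series is available. -/
theorem lipschitzSum_one_sub (z : ℂ) : lipschitzSum (1 - z) = -lipschitzSum z := by
  rw [sub_eq_add_neg, lipschitzSum_one_add, lipschitzSum_neg]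

theorem norm_exp_two_pi_I_mul (z : ℂ) : ‖exp (2 * π * I * z)‖ = Real.exp (-(2 * π * z.im)) := by
  rw [Complex.norm_exp]
  congr 1
  rw [show (2 * π * I * z : ℂ) = ((2 * π : ℝ) : ℂ) * (I * z) by push_cast; ring,
    Complex.re_ofReal_mul, Complex.I_mul_re]
  ring

/-- This is Lipschitz's formula for exponent 3, whose constant is (-2πi)³/2! = 4π³i. The term n = 0
vanishes because of the factor n². -/
theorem hasSum_lipschitzSum {z : ℂ} (hz : 0 < z.im) :
    HasSum (fun n : ℕ => ((n : ℂ) + 1) ^ 2 * exp (2 * π * I * z) ^ (n + 1))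
      (lipschitzSum z / (4 * π ^ 3 * I)) := by
  have hπ : (π : ℂ) ≠ 0 := by exact_mod_cast Real.pi_ne_zero
  have hq : ‖exp (2 * π * I * z)‖ < 1 := by
    rw [norm_exp_two_pi_I_mul, Real.exp_lt_one_iff]
    have := Real.pi_pos
    simp only [Left.neg_neg_iff]
    positivity
  have hs : Summable fun n : ℕ => (n : ℂ) ^ 2 * exp (2 * π * I * z) ^ n :=
    summable_pow_mul_geometric_of_norm_lt_one 2 hq
  have h := EisensteinSeries.qExpansion_identity (k := 2) (by norm_num) ⟨z, hz⟩
  change lipschitzSum z = (-2 * π * I) ^ 3 / (2 : ℕ).factorial *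
    ∑' n : ℕ, (n : ℂ) ^ 2 * exp (2 * π * I * z) ^ n at h
  have hI : (-2 * π * I) ^ 3 / ((2 : ℕ).factorial : ℂ) = 4 * π ^ 3 * I := by
    rw [mul_pow, Complex.I_pow_three]
    norm_num [Nat.factorial]
    ring
  rw [hI, hs.tsum_eq_zero_add] at h
  have h2 := ((summable_nat_add_iff 1).2 hs).hasSum
  have e : lipschitzSum z / (4 * π ^ 3 * I)
      = ∑' n : ℕ, ((n + 1 : ℕ) : ℂ) ^ 2 * exp (2 * π * I * z) ^ (n + 1) := by
    rw [h]
    field_simp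
    simp
  rw [e]
  exact h2.congr_fun fun n => by push_cast; rfl

/-- In the upper half plane the q-series is dominated by its first term; oddness carries the bound
to the lower one. -/
theorem norm_lipschitzSum_le : ∃ K : ℝ, 0 ≤ K ∧ ∀ z : ℂ, 1 ≤ |z.im| →
    ‖lipschitzSum z‖ ≤ K * Real.exp (-(2 * π * |z.im|)) := by
  have hs : Summable fun n : ℕ => ((n : ℝ) + 1) ^ 2 * Real.exp (-(n : ℝ)) := by
    refine (((summable_pow_mul_exp_neg 2 one_pos).mul_left (Real.exp 1))).congr fun n => ?_
    rw [show -(n : ℝ) = 1 + -(((n : ℝ) + 1) * 1) by ring, Real.exp_add]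
    ring
  set K := ∑' n : ℕ, ((n : ℝ) + 1) ^ 2 * Real.exp (-(n : ℝ)) with hK
  have hK0 : 0 ≤ K := tsum_nonneg fun n => by positivity
  have key : ∀ z : ℂ, 1 ≤ z.im →
      ‖lipschitzSum z‖ ≤ 4 * π ^ 3 * K * Real.exp (-(2 * π * z.im)) := by
    intro z hz
    have h := hasSum_lipschitzSum (by linarith : 0 < z.im)
    have hb : ‖lipschitzSum z / (4 * π ^ 3 * I)‖ ≤ K * Real.exp (-(2 * π * z.im)) := by
      rw [← h.tsum_eq, hK, ← tsum_mul_right]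
      refine tsum_of_norm_bounded (hs.mul_right _).hasSum fun n => ?_
      have h1 : ‖(n : ℂ) + 1‖ = (n : ℝ) + 1 := by exact_mod_cast Complex.norm_natCast (n + 1)
      rw [norm_mul, norm_pow, norm_pow, h1, norm_exp_two_pi_I_mul]
      have h6 : Real.exp (-(2 * π * z.im)) ^ (n + 1)
          ≤ Real.exp (-(n : ℝ)) * Real.exp (-(2 * π * z.im)) := by
        rw [← Real.exp_nat_mul, ← Real.exp_add]
        refine Real.exp_le_exp.2 ?_
        push_cast
        have h2 : 1 ≤ 2 * π * z.im := by nlinarith [Real.pi_gt_three]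
        have h3 : (0 : ℝ) ≤ n := by positivity
        nlinarith
      have h7 := mul_le_mul_of_nonneg_left h6 (by positivity : 0 ≤ ((n : ℝ) + 1) ^ 2)
      simpa only [mul_assoc] using h7
    rw [norm_div, norm_mul, Complex.norm_I, mul_one, norm_mul, norm_pow, Complex.norm_real,
      Real.norm_of_nonneg Real.pi_pos.le, Complex.norm_ofNat, div_le_iff₀ (by positivity)] at hb
    linarith
  refine ⟨4 * π ^ 3 * K, by positivity, fun z hz => ?_⟩
  rcases le_total 0 z.im with h | h
  · rw [abs_of_nonneg h] at hz ⊢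
    exact key z hz
  · rw [abs_of_nonpos h] at hz ⊢
    have := key (-z) (by simpa using hz)
    rwa [lipschitzSum_neg, norm_neg, Complex.neg_im] at this

/-- Exponent 3 exceeds the rank 2 of the lattice, so the Weierstrass-type series over the period
pair (τ, 1) converges absolutely. Terms with a vanishing denominator count as zero. -/
theorem summable_lattice (v : ℂ) {τ : ℂ} (hτ : 0 < τ.im) :
    Summable fun p : ℤ × ℤ => 1 / (v + p.1 * τ + p.2) ^ 3 := by
  have hind : LinearIndependent ℝ ![τ, 1] := by
    rw [LinearIndependent.pair_iff]
    intro s t h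
    have him := congrArg Complex.im h
    have hre := congrArg Complex.re h
    simp at him hre
    have hs : s = 0 := by
      rcases him with h | h
      · exact h
      · exact absurd h hτ.ne'
    rw [hs] at hre
    exact ⟨hs, by simpa using hre⟩
  let L : PeriodPair := ⟨τ, 1, hind⟩
  have h := (L.hasSum_sumInvPow (-v) (r := 3) (by norm_num)).summable
  refine (L.latticeEquivProd.symm.toEquiv.summable_iff.2 h).congr fun p => ?_
  have e : ((L.latticeEquivProd.symm p : L.lattice) : ℂ) = p.1 * τ + p.2 * 1 :=
    L.latticeEquiv_symm_apply p
  simp only [Function.comp_apply, LinearEquiv.coe_toEquiv, e, one_div]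
  ring_nf

/-- One absolutely convergent lattice sum is taken in both orders. Summing over j first and
extracting τ³ gives the left side; summing over m first gives the rows on the right, with j = 0 set
apart and ±j paired. -/
theorem tsum_lipschitzSum_eq (v : ℂ) {τ : ℂ} (hτ : 0 < τ.im) :
    ∑' m : ℤ, (τ ^ 3)⁻¹ * lipschitzSum ((v + m) / τ) = lipschitzSum v
      + ∑' j : ℕ, (lipschitzSum (v + (j + 1) * τ) + lipschitzSum (v - (j + 1) * τ)) := by
  have hτ0 : τ ≠ 0 := by rintro rfl; simp at hτ
  have hs := summable_lattice v hτ
  have hcol := hs.prod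
  have e1 : ∀ m : ℤ, (τ ^ 3)⁻¹ * lipschitzSum ((v + m) / τ)
      = ∑' j : ℤ, 1 / (v + j * τ + m) ^ 3 := by
    intro m
    rw [lipschitzSum, ← tsum_mul_left]
    refine tsum_congr fun j => ?_
    rw [show v + j * τ + m = τ * ((v + m) / τ + j) by field_simp; ring, mul_pow, one_div, one_div,
      mul_inv]
  simp_rw [e1]
  rw [Summable.tsum_comm (f := fun (j m : ℤ) => 1 / (v + j * τ + m) ^ 3) hs]
  have hpos : Summable fun n : ℕ => ∑' m : ℤ, 1 / (v + ((n : ℤ) + 1 : ℤ) * τ + m) ^ 3 :=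
    hcol.comp_injective (i := fun n : ℕ => (n : ℤ) + 1) fun a b h => by simpa using h
  have hneg : Summable fun n : ℕ => ∑' m : ℤ, 1 / (v + (-((n : ℤ) + 1) : ℤ) * τ + m) ^ 3 :=
    hcol.comp_injective (i := fun n : ℕ => -((n : ℤ) + 1)) fun a b h => by simpa using h
  rw [tsum_of_add_one_of_neg_add_one (f := fun j : ℤ => ∑' m : ℤ, 1 / (v + j * τ + m) ^ 3)
    hpos hneg, add_right_comm, ← hpos.tsum_add hneg, add_comm]
  congr 1
  · simp [lipschitzSum]
  · refine tsum_congr fun n => ?_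
    simp only [lipschitzSum]
    push_cast
    congr 1
    refine tsum_congr fun m => ?_
    ring_nf

/-- Expand 1/(e^{nw} - 1) = ∑_{j ≥ 1} e^{-njw} and exchange the sums. For fixed j, the two
exponentials of the sine give q-series of Lipschitz sums, and (-1)ⁿ is the shift by 1/2. The
hypothesis makes the double series absolutely convergent and keeps the points in the upper half
plane for both signs of a. -/
theorem sinSum_two_eq {w a : ℂ} (ha : 2 * |a.im| < w.re) :
    sinSum 2 w a = -(1 / (8 * π ^ 3)) * ∑' j : ℕ,
      (lipschitzSum (1 / 2 + a / π + (j + 1) * (I * w / (2 * π)))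
        + lipschitzSum (1 / 2 + a / π - (j + 1) * (I * w / (2 * π)))) := by
  have hπ : (π : ℂ) ≠ 0 := by exact_mod_cast Real.pi_ne_zero
  have hw : 0 < w.re := lt_of_le_of_lt (by positivity) ha
  set T : ℕ → ℕ → ℂ := fun n j => ((n : ℂ) + 1) ^ 2 * (-1) ^ (n + 1)
    * Complex.sin (2 * ((n : ℂ) + 1) * a) * exp (-(((n : ℂ) + 1) * w)) ^ (j + 1) with hT
  have hTs : Summable (Function.uncurry T) := by
    have h1 := summable_pow_mul_exp_neg 2 (sub_pos.2 ha)
    have h2 : Summable fun j : ℕ => Real.exp (-w.re) ^ j :=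
      summable_geometric_of_lt_one (Real.exp_pos _).le (by simpa using hw)
    refine Summable.of_norm_bounded (h1.mul_of_nonneg h2 (fun n => by positivity)
      (fun n => by positivity)) ?_
    rintro ⟨n, j⟩
    have h3 : ‖(n : ℂ) + 1‖ = (n : ℝ) + 1 := by exact_mod_cast Complex.norm_natCast (n + 1)
    have h4 : ‖Complex.sin (2 * ((n : ℂ) + 1) * a)‖ ≤ Real.exp (((n : ℝ) + 1) * (2 * |a.im|)) := by
      rw [← abs_im_two_mul_natCast_mul]
      exact norm_sin_le_exp_abs_im _
    have h5 : ‖exp (-(((n : ℂ) + 1) * w))‖ = Real.exp (-(((n : ℝ) + 1) * w.re)) := by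
      rw [Complex.norm_exp]
      simp
    simp only [Function.uncurry, hT, norm_mul, norm_pow, h3, h5, norm_neg, norm_one, one_pow,
      mul_one]
    have h6 : ‖Complex.sin (2 * ((n : ℂ) + 1) * a)‖ * Real.exp (-(((n : ℝ) + 1) * w.re)) ^ (j + 1)
        ≤ Real.exp (-(((n : ℝ) + 1) * (w.re - 2 * |a.im|))) * Real.exp (-w.re) ^ j := by
      refine (mul_le_mul_of_nonneg_right h4 (by positivity)).trans ?_
      rw [← Real.exp_nat_mul, ← Real.exp_nat_mul, ← Real.exp_add, ← Real.exp_add]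
      refine Real.exp_le_exp.2 ?_
      push_cast
      have : 0 ≤ (n : ℝ) * j * w.re := by positivity
      linarith
    have h7 := mul_le_mul_of_nonneg_left h6 (by positivity : 0 ≤ ((n : ℝ) + 1) ^ 2)
    simpa only [mul_assoc] using h7
  have hrow : ∀ n, ∑' j, T n j = ((n : ℂ) + 1) ^ 2 * (-1) ^ (n + 1)
      / (exp (((n : ℂ) + 1) * w) - 1) * Complex.sin (2 * ((n : ℂ) + 1) * a) := by
    intro n
    have hq : ‖exp (-(((n : ℂ) + 1) * w))‖ < 1 := by
      rw [Complex.norm_exp, Real.exp_lt_one_iff]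
      have : 0 < ((n : ℝ) + 1) * w.re := by positivity
      simpa using this
    simp only [hT, pow_succ _, tsum_mul_left, tsum_mul_right]
    rw [tsum_geometric_of_norm_lt_one hq, Complex.exp_neg]
    have h0 := Complex.exp_ne_zero (((n : ℂ) + 1) * w)
    have h1 : exp (((n : ℂ) + 1) * w) - 1 ≠ 0 := by
      intro h
      rw [sub_eq_zero] at h
      rw [Complex.exp_neg, h] at hq
      simp at hq
    have h2 : 1 - (exp (((n : ℂ) + 1) * w))⁻¹ ≠ 0 := by
      intro h
      apply h1
      rw [sub_eq_zero, eq_comm, inv_eq_one] at h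
      rw [h, sub_self]
    field_simp
  have hcol : ∀ j : ℕ, ∑' n, T n j = -(1 / (8 * π ^ 3)) *
      (lipschitzSum (1 / 2 + a / π + (j + 1) * (I * w / (2 * π)))
        + lipschitzSum (1 / 2 + a / π - (j + 1) * (I * w / (2 * π)))) := by
    intro j
    have him : ∀ b : ℂ, |b.im| = |a.im| →
        0 < (1 / 2 + b / π + (j + 1) * (I * w / (2 * π)) : ℂ).im := by
      intro b hb
      have e : (1 / 2 + b / π + (j + 1) * (I * w / (2 * π)) : ℂ).im
          = (2 * b.im + ((j : ℝ) + 1) * w.re) / (2 * π) := by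
        rw [show (1 / 2 + b / π + (j + 1) * (I * w / (2 * π)) : ℂ)
          = ((1 / 2 : ℝ) : ℂ) + ((1 / π : ℝ) : ℂ) * b + ((((j : ℝ) + 1) / (2 * π) : ℝ) : ℂ) * (I * w)
          by push_cast; field_simp]
        simp only [Complex.add_im, Complex.im_ofReal_mul, Complex.ofReal_im, Complex.I_mul_im]
        field_simp
        ring
      rw [e]
      have h1 : -|b.im| ≤ b.im := neg_abs_le _
      have h2 : 0 ≤ (j : ℝ) * w.re := by positivity
      have : 0 < 2 * b.im + ((j : ℝ) + 1) * w.re := by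
        rw [hb] at h1
        linarith
      positivity
    have hp := hasSum_lipschitzSum (him a rfl)
    have hm := hasSum_lipschitzSum (him (-a) (by simp))
    -- The point belonging to -a is the reflection of the wanted one, which lies in the lower half
    -- plane.
    have e2 : (1 / 2 + -a / π + (j + 1) * (I * w / (2 * π)) : ℂ)
        = 1 - (1 / 2 + a / π - (j + 1) * (I * w / (2 * π))) := by ring
    have hexp : ∀ (b : ℂ) (n : ℕ), exp (2 * π * I * (1 / 2 + b / π + (j + 1) * (I * w / (2 * π))))
        ^ (n + 1) = (-1) ^ (n + 1) * exp (2 * ((n : ℂ) + 1) * b * I)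
          * exp (-(((n : ℂ) + 1) * w)) ^ (j + 1) := by
      intro b n
      rw [← Complex.exp_pi_mul_I, ← Complex.exp_nat_mul, ← Complex.exp_nat_mul,
        ← Complex.exp_nat_mul, ← Complex.exp_add, ← Complex.exp_add]
      congr 1
      push_cast
      field_simp
      linear_combination ((j : ℂ) + 1) * w * Complex.I_sq
    have hsum := (hm.sub hp).mul_left (I / 2)
    rw [e2, lipschitzSum_one_sub, ← e2] at hsum
    refine ((hsum.congr_fun fun n => ?_).tsum_eq).trans ?_
    · rw [hexp, hexp, hT]
      simp only [Complex.sin]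
      rw [show -(2 * ((n : ℂ) + 1) * a) * I = 2 * ((n : ℂ) + 1) * -a * I by ring]
      ring
    · field_simp
      ring
  rw [sinSum, ← tsum_mul_left]
  simp_rw [← hrow, ← hcol]
  exact (Summable.tsum_comm hTs).symm

/-- This is the missing row j = 0. Here q = -e^{2ia}, and the series ∑ n² qⁿ is rational in q, by
writing (n+1)² = 2·C(n+2, 2) - C(n+1, 1). The condition Im a > 0 makes this series converge. -/
theorem lipschitzSum_half_add {a : ℂ} (ha : 0 < a.im) :
    lipschitzSum (1 / 2 + a / π) = -π ^ 3 * (Complex.tan a / Complex.cos a ^ 2) := by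
  have hπ : (π : ℂ) ≠ 0 := by exact_mod_cast Real.pi_ne_zero
  have him : 0 < (1 / 2 + a / π : ℂ).im := by
    rw [show (1 / 2 + a / π : ℂ) = ((1 / 2 : ℝ) : ℂ) + ((1 / π : ℝ) : ℂ) * a by
      push_cast; ring, Complex.add_im, Complex.im_ofReal_mul, Complex.ofReal_im]
    have := Real.pi_pos
    positivity
  set E := exp (a * I) with hE
  have hE0 : E ≠ 0 := Complex.exp_ne_zero _
  have hEn : ‖E‖ < 1 := by
    rw [hE, Complex.norm_exp]
    simpa using ha
  have hp : exp (2 * π * I * (1 / 2 + a / π)) = -E ^ 2 := by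
    rw [hE, ← Complex.exp_nat_mul, ← neg_one_mul, ← Complex.exp_pi_mul_I, ← Complex.exp_add]
    congr 1
    push_cast
    field_simp
  have hpn : ‖-E ^ 2‖ < 1 := by
    rw [norm_neg, norm_pow]
    exact pow_lt_one₀ (norm_nonneg _) hEn (by norm_num)
  have h1 := hasSum_lipschitzSum him
  rw [hp] at h1
  have h2 := ((((hasSum_choose_mul_geometric_of_norm_lt_one 2 hpn).mul_left 2).sub
    (hasSum_choose_mul_geometric_of_norm_lt_one 1 hpn)).mul_left (-E ^ 2))
  have h3 : (fun n : ℕ => ((n : ℂ) + 1) ^ 2 * (-E ^ 2) ^ (n + 1)) = fun n : ℕ =>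
      -E ^ 2 * (2 * (((n + 2).choose 2 : ℕ) * (-E ^ 2) ^ n)
        - ((n + 1).choose 1 : ℕ) * (-E ^ 2) ^ n) := by
    funext n
    rw [Nat.cast_choose_two, Nat.choose_one_right]
    push_cast
    ring
  rw [h3] at h1
  have h4 := h1.unique h2
  have hne : 1 + E ^ 2 ≠ 0 := by
    intro h
    have : E ^ 2 = -1 := by linear_combination h
    have h5 : ‖E ^ 2‖ = 1 := by rw [this]; simp
    rw [norm_neg] at hpn
    exact hpn.ne h5
  have hcos : Complex.cos a = (E ^ 2 + 1) / (2 * E) := by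
    rw [Complex.cos, neg_mul, Complex.exp_neg, ← hE]
    field_simp
  have hsin : Complex.sin a = (1 - E ^ 2) * I / (2 * E) := by
    rw [Complex.sin, neg_mul, Complex.exp_neg, ← hE]
    field_simp
  rw [Complex.tan, hcos, hsin]
  have hne' : E ^ 2 + 1 ≠ 0 := by rwa [add_comm] at hne
  rw [div_eq_iff (by simp [hπ])] at h4
  rw [h4, sub_neg_eq_add]
  field_simp
  ring

end AdSDistillate

namespace AdSDistillate

/-! ### Exponentially small remainders -/

open Complex (exp I)
open scoped Real

theorem summable_exp_one_sub_abs : Summable fun m : ℤ => Real.exp (1 - |(m : ℝ)|) := by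
  have h : Summable fun n : ℕ => Real.exp (1 - (n : ℝ)) := by
    refine (Real.summable_exp_neg_nat.mul_left (Real.exp 1)).congr fun n => ?_
    rw [← Real.exp_add]
    rfl
  exact Summable.of_nat_of_neg (h.congr fun n => by simp) (h.congr fun n => by simp)

/-- Adding tan a / (8 cos² a) restores the row j = 0, so the left side is a complete lattice sum,
which is then read in the other order. Its points (v + m)/τ equal -i((2m+1)π/w + 2a/w), and `M`
bounds |2a/w|. Their distance from the real axis is therefore at least |2m+1|π Re(1/w) - M, and
|2m+1| ≥ 1 gives the exponent 2π² Re(1/w). -/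
theorem norm_sinSum_two_add_le_of_im_pos : ∃ K : ℝ, 0 ≤ K ∧ ∀ (w a : ℂ) (M : ℝ),
    2 * |a.im| < w.re → 0 < a.im → 2 * ‖a‖ ≤ M * ‖w‖ → M + 1 ≤ π * (w⁻¹).re →
    ‖sinSum 2 w a + Complex.tan a / (8 * Complex.cos a ^ 2)‖
      ≤ K * Real.exp (2 * π * M) * ‖w‖⁻¹ ^ 3 * Real.exp (-(2 * π ^ 2 * (w⁻¹).re)) := by
  obtain ⟨K, hK0, hK⟩ := norm_lipschitzSum_le
  refine ⟨K * ∑' m : ℤ, Real.exp (1 - |(m : ℝ)|),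
    mul_nonneg hK0 (tsum_nonneg fun m => (Real.exp_pos _).le), ?_⟩
  intro w a M ha hapos hM hY
  have hπ : (π : ℂ) ≠ 0 := by exact_mod_cast Real.pi_ne_zero
  have hπ0 := Real.pi_pos
  have hw : 0 < w.re := lt_of_le_of_lt (by positivity) ha
  have hw0 : w ≠ 0 := by rintro rfl; simp at hw
  have hwn : 0 < ‖w‖ := norm_pos_iff.2 hw0
  have hM0 : 0 ≤ M := by
    by_contra h
    have : M * ‖w‖ < 0 := mul_neg_of_neg_of_pos (not_le.1 h) hwn
    linarith [norm_nonneg a]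
  set Y := (w⁻¹).re with hYdef
  have hτ : 0 < (I * w / (2 * π)).im := by
    have := (tau w hw).im_pos
    rwa [← UpperHalfPlane.coe_im, coe_tau] at this
  have hT := tsum_lipschitzSum_eq (1 / 2 + a / π) hτ
  have h1 : sinSum 2 w a + Complex.tan a / (8 * Complex.cos a ^ 2)
      = -(1 / (8 * π ^ 3)) * ∑' m : ℤ, ((I * w / (2 * π)) ^ 3)⁻¹
        * lipschitzSum ((1 / 2 + a / π + m) / (I * w / (2 * π))) := by
    have key : ∀ S t c : ℂ, -(1 / (8 * π ^ 3)) * S + t / (8 * c)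
        = -(1 / (8 * π ^ 3)) * (-π ^ 3 * (t / c) + S) := by
      intro S t c
      field_simp
      ring
    rw [hT, sinSum_two_eq ha, lipschitzSum_half_add hapos]
    exact key _ _ _
  have h2 : ∀ m : ℤ, |2 * (m : ℝ) + 1| * (π * Y) - M
      ≤ |((1 / 2 + a / π + m) / (I * w / (2 * π))).im| := by
    intro m
    have e : (1 / 2 + a / π + m) / (I * w / (2 * π))
        = -(I * ((((2 * (m : ℝ) + 1) * π : ℝ) : ℂ) * w⁻¹ + 2 * a / w)) := by
      have hI := Complex.I_ne_zero
      push_cast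
      field_simp
      rw [Complex.I_sq]
      ring
    have h3 : |(2 * a / w).re| ≤ M := by
      refine (Complex.abs_re_le_norm _).trans ?_
      rw [norm_div, norm_mul, Complex.norm_ofNat, div_le_iff₀ hwn]
      exact hM
    rw [e, Complex.neg_im, Complex.I_mul_im, Complex.add_re, Complex.re_ofReal_mul, abs_neg]
    have h4 : |2 * (m : ℝ) + 1| * (π * Y) = |(2 * (m : ℝ) + 1) * π * Y| := by
      rw [mul_assoc, abs_mul, abs_of_nonneg (by linarith : 0 ≤ π * Y)]
    have h5 := abs_sub_abs_le_abs_sub ((2 * (m : ℝ) + 1) * π * Y) (-(2 * a / w).re)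
    rw [sub_neg_eq_add, abs_neg] at h5
    linarith
  have habs : ∀ m : ℤ, 1 ≤ |2 * (m : ℝ) + 1| ∧ |(m : ℝ)| ≤ |2 * (m : ℝ) + 1| := by
    intro m
    have : (1 : ℤ) ≤ |2 * m + 1| ∧ |m| ≤ |2 * m + 1| := by
      rcases le_total 0 m with h | h
      · rw [abs_of_nonneg h, abs_of_nonneg (by omega)]
        omega
      · rcases eq_or_lt_of_le h with rfl | h
        · simp
        · rw [abs_of_neg h, abs_of_neg (by omega)]
          omega
    exact_mod_cast this
  have h3 : ∀ m : ℤ, ‖lipschitzSum ((1 / 2 + a / π + m) / (I * w / (2 * π)))‖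
      ≤ K * (Real.exp (2 * π * M) * Real.exp (-(2 * π ^ 2 * Y))) * Real.exp (1 - |(m : ℝ)|) := by
    intro m
    obtain ⟨hm1, hm2⟩ := habs m
    have h4 : 1 ≤ |((1 / 2 + a / π + m) / (I * w / (2 * π))).im| := by
      refine le_trans ?_ (h2 m)
      nlinarith
    refine (hK _ h4).trans ?_
    rw [mul_assoc K]
    refine mul_le_mul_of_nonneg_left ?_ hK0
    rw [← Real.exp_add, ← Real.exp_add]
    refine Real.exp_le_exp.2 ?_
    have h5 := mul_le_mul_of_nonneg_left (h2 m) (by positivity : 0 ≤ 2 * π)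
    -- The excess of |2m+1| over 1 is spent on summability in m.
    have h6 : |(m : ℝ)| - 1 ≤ 2 * π * ((|2 * (m : ℝ) + 1| - 1) * (π * Y)) := by
      have h7 : |2 * (m : ℝ) + 1| - 1 ≤ (|2 * (m : ℝ) + 1| - 1) * (π * Y) := by nlinarith
      nlinarith [Real.pi_gt_three]
    nlinarith
  have h4 : ‖((I * w / (2 * π)) ^ 3)⁻¹‖ = 8 * π ^ 3 * ‖w‖⁻¹ ^ 3 := by
    rw [norm_inv, norm_pow, norm_div, norm_mul, Complex.norm_I, norm_mul, Complex.norm_ofNat,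
      Complex.norm_real, Real.norm_of_nonneg hπ0.le]
    field_simp
    norm_num
  have h5 : ‖∑' m : ℤ, ((I * w / (2 * π)) ^ 3)⁻¹
        * lipschitzSum ((1 / 2 + a / π + m) / (I * w / (2 * π)))‖
      ≤ (8 * π ^ 3 * ‖w‖⁻¹ ^ 3 * (K * (Real.exp (2 * π * M) * Real.exp (-(2 * π ^ 2 * Y)))))
        * ∑' m : ℤ, Real.exp (1 - |(m : ℝ)|) := by
    refine tsum_of_norm_bounded (summable_exp_one_sub_abs.hasSum.mul_left _) fun m => ?_
    rw [norm_mul, h4, mul_assoc _ (K * _)]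
    exact mul_le_mul_of_nonneg_left (h3 m) (by positivity)
  rw [h1, norm_mul]
  have h6 : ‖(-(1 / (8 * π ^ 3)) : ℂ)‖ = 1 / (8 * π ^ 3) := by
    rw [norm_neg, norm_div, norm_one, norm_mul, norm_pow, Complex.norm_real,
      Real.norm_of_nonneg hπ0.le, Complex.norm_ofNat]
  rw [h6]
  refine (mul_le_mul_of_nonneg_left h5 (by positivity)).trans_eq ?_
  field_simp

/-! ### Differentiation in a, and integration of the remainders from a = 0. -/

theorem norm_coeff_le (m : ℕ) {w : ℂ} (hw : 0 < w.re) (n : ℕ) :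
    ‖((n : ℂ) + 1) ^ m * (-1) ^ (n + 1) / (exp (((n : ℂ) + 1) * w) - 1)‖
      ≤ (1 - Real.exp (-w.re))⁻¹ * (((n : ℝ) + 1) ^ m * Real.exp (-(((n : ℝ) + 1) * w.re))) := by
  have h1 : ‖(n : ℂ) + 1‖ = (n : ℝ) + 1 := by exact_mod_cast Complex.norm_natCast (n + 1)
  rw [div_eq_mul_inv, norm_mul, norm_mul, norm_pow, norm_pow, h1, norm_neg, norm_one, one_pow,
    mul_one]
  refine (mul_le_mul_of_nonneg_left (norm_inv_exp_sub_one_le hw n) (by positivity)).trans_eq ?_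
  ring

/-- On a strip 2|Im b| < σ with σ < Re w there is a uniform summable majorant, so the holomorphic
terms may be differentiated one by one. Each derivative brings down 2n and raises the power of n. -/
theorem hasDerivAt_tsum_coeff (m : ℕ) {w a : ℂ} (ha : 2 * |a.im| < w.re) {φ φ' : ℂ → ℂ}
    (hφ : ∀ z, HasDerivAt φ (φ' z) z) (hb : ∀ z, ‖φ z‖ ≤ Real.exp |z.im|) :
    HasDerivAt (fun b => ∑' n : ℕ, ((n : ℂ) + 1) ^ m * (-1) ^ (n + 1)
        / (exp (((n : ℂ) + 1) * w) - 1) * φ (2 * ((n : ℂ) + 1) * b))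
      (2 * ∑' n : ℕ, ((n : ℂ) + 1) ^ (m + 1) * (-1) ^ (n + 1)
        / (exp (((n : ℂ) + 1) * w) - 1) * φ' (2 * ((n : ℂ) + 1) * a)) a := by
  have hw : 0 < w.re := lt_of_le_of_lt (by positivity) ha
  obtain ⟨σ, hσ1, hσ2⟩ := exists_between ha
  set U : Set ℂ := {b | 2 * |b.im| < σ}
  have hU : IsOpen U := isOpen_lt (by fun_prop) continuous_const
  have haU : a ∈ U := hσ1
  set F : ℕ → ℂ → ℂ := fun n b => ((n : ℂ) + 1) ^ m * (-1) ^ (n + 1)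
        / (exp (((n : ℂ) + 1) * w) - 1) * φ (2 * ((n : ℂ) + 1) * b) with hF
  have hFd : ∀ n b, HasDerivAt (F n) (2 * (((n : ℂ) + 1) ^ (m + 1) * (-1) ^ (n + 1)
        / (exp (((n : ℂ) + 1) * w) - 1) * φ' (2 * ((n : ℂ) + 1) * b))) b := by
    intro n b
    have h1 : HasDerivAt (fun b : ℂ => 2 * ((n : ℂ) + 1) * b) (2 * ((n : ℂ) + 1)) b := by
      simpa using (hasDerivAt_id b).const_mul (2 * ((n : ℂ) + 1))
    exact (((hφ _).comp b h1).const_mul _).congr_deriv (by ring)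
  set u : ℕ → ℝ := fun n => (1 - Real.exp (-w.re))⁻¹
    * (((n : ℝ) + 1) ^ m * Real.exp (-(((n : ℝ) + 1) * (w.re - σ)))) with hu
  have hus : Summable u := (summable_pow_mul_exp_neg m (sub_pos.2 hσ2)).mul_left _
  have hbound : ∀ n, ∀ b ∈ U, ‖F n b‖ ≤ u n := by
    intro n b hbU
    rw [hF, norm_mul]
    have h1 : ‖φ (2 * ((n : ℂ) + 1) * b)‖ ≤ Real.exp (((n : ℝ) + 1) * σ) := by
      refine (hb _).trans (Real.exp_le_exp.2 ?_)
      rw [abs_im_two_mul_natCast_mul]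
      exact mul_le_mul_of_nonneg_left hbU.le (by positivity)
    refine (mul_le_mul (norm_coeff_le m hw n) h1 (norm_nonneg _)
      ((norm_nonneg _).trans (norm_coeff_le m hw n))).trans_eq ?_
    rw [hu, mul_assoc, mul_assoc, ← Real.exp_add]
    ring_nf
  have hd := Complex.differentiableOn_tsum_of_summable_norm hus
    (fun n b _ => (hFd n b).differentiableAt.differentiableWithinAt) hU hbound
  have hs := Complex.hasSum_deriv_of_summable_norm hus
    (fun n b _ => (hFd n b).differentiableAt.differentiableWithinAt) hU hbound haU
  refine ((hd.differentiableAt (hU.mem_nhds haU)).hasDerivAt).congr_deriv ?_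
  rw [← hs.tsum_eq, ← tsum_mul_left]
  exact tsum_congr fun n => (hFd n a).deriv

theorem hasDerivAt_sinSum (m : ℕ) {w a : ℂ} (ha : 2 * |a.im| < w.re) :
    HasDerivAt (sinSum m w) (2 * cosSum (m + 1) w a) a :=
  hasDerivAt_tsum_coeff m ha Complex.hasDerivAt_sin norm_sin_le_exp_abs_im

theorem hasDerivAt_cosSum (m : ℕ) {w a : ℂ} (ha : 2 * |a.im| < w.re) :
    HasDerivAt (cosSum m w) (-2 * sinSum (m + 1) w a) a := by
  refine (hasDerivAt_tsum_coeff m ha Complex.hasDerivAt_cos norm_cos_le_exp_abs_im).congr_deriv ?_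
  simp only [sinSum, mul_neg, tsum_neg]
  ring

theorem sinSum_neg (m : ℕ) (w a : ℂ) : sinSum m w (-a) = -sinSum m w a := by
  rw [sinSum, sinSum, ← tsum_neg]
  refine tsum_congr fun n => ?_
  rw [mul_neg, Complex.sin_neg]
  ring

theorem cos_ne_zero_of_norm_lt_one {a : ℂ} (ha : ‖a‖ < 1) : Complex.cos a ≠ 0 := by
  intro h
  obtain ⟨k, hk⟩ := Complex.cos_eq_zero_iff.1 h
  have h1 : a = (((2 * k + 1) * π / 2 : ℝ) : ℂ) := by rw [hk]; push_cast; rfl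
  rw [h1, Complex.norm_real, Real.norm_eq_abs, abs_div, abs_mul, abs_of_pos Real.pi_pos,
    abs_two] at ha
  have h2 : (1 : ℝ) ≤ |2 * (k : ℝ) + 1| := by
    have : (1 : ℤ) ≤ |2 * k + 1| := Int.one_le_abs (by omega)
    exact_mod_cast this
  nlinarith [Real.pi_gt_three]

/-- Oddness in a covers Im a < 0. Real a is a limit of a + iε, and the strict bounds on a persist
under this small shift. -/
theorem norm_sinSum_two_add_le : ∃ K : ℝ, 0 ≤ K ∧ ∀ (w a : ℂ) (M : ℝ),
    2 * |a.im| < w.re → 2 * ‖a‖ < M * ‖w‖ → ‖a‖ < 1 → M + 1 ≤ π * (w⁻¹).re →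
    ‖sinSum 2 w a + Complex.tan a / (8 * Complex.cos a ^ 2)‖
      ≤ K * Real.exp (2 * π * M) * ‖w‖⁻¹ ^ 3 * Real.exp (-(2 * π ^ 2 * (w⁻¹).re)) := by
  obtain ⟨K, hK0, hK⟩ := norm_sinSum_two_add_le_of_im_pos
  refine ⟨K, hK0, fun w a M ha hM ha1 hY => ?_⟩
  rcases lt_trichotomy a.im 0 with h | h | h
  · have := hK w (-a) M (by simpa using ha) (by simpa using h) (by simpa using hM.le) hY
    rwa [sinSum_neg, Complex.tan_neg, Complex.cos_neg, neg_div, ← neg_add, norm_neg] at this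
  · have hcos := cos_ne_zero_of_norm_lt_one ha1
    have hc : ContinuousAt (fun b : ℂ => ‖sinSum 2 w b
        + Complex.tan b / (8 * Complex.cos b ^ 2)‖) a :=
      ((hasDerivAt_sinSum 2 ha).continuousAt.add
        ((Complex.continuousAt_tan.2 hcos).div (by fun_prop) (by simpa using hcos))).norm
    have hp : ContinuousAt (fun ε : ℝ => a + ε * I) 0 := by fun_prop
    have hp0 : a + ((0 : ℝ) : ℂ) * I = a := by simp
    have hlim : Tendsto (fun ε : ℝ => a + ε * I) (𝓝[>] 0) (𝓝 a) := by
      have := hp.tendsto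
      rw [hp0] at this
      exact this.mono_left nhdsWithin_le_nhds
    refine le_of_tendsto (hc.tendsto.comp hlim) ?_
    have e1 : ∀ᶠ b in 𝓝 a, 2 * |b.im| < w.re :=
      (isOpen_lt (by fun_prop) continuous_const).mem_nhds ha
    have e2 : ∀ᶠ b in 𝓝 a, 2 * ‖b‖ < M * ‖w‖ :=
      (isOpen_lt (by fun_prop) continuous_const).mem_nhds hM
    filter_upwards [hlim.eventually e1, hlim.eventually e2, self_mem_nhdsWithin] with ε h1 h2 h3
    exact hK w _ M h1 (by simpa [h] using h3) h2.le hY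
  · exact hK w a M ha h hM.le hY

/-- This fixes the constant of integration of C₁. Of the two modular images, the one at 2π²/w decays
more slowly and sets the rate. -/
theorem norm_cosSum_one_zero_le : ∃ K : ℝ, 0 ≤ K ∧ ∀ w : ℂ, 0 < w.re → 1 ≤ π * (w⁻¹).re →
    ‖cosSum 1 w 0 + 1 / (2 * w) - 1 / 8‖
      ≤ K * ‖w‖⁻¹ ^ 2 * Real.exp (-(2 * π ^ 2 * (w⁻¹).re)) := by
  obtain ⟨K, hK0, hK⟩ := norm_lambert_le 1
  refine ⟨8 * π ^ 2 * K, by positivity, fun w hw hY => ?_⟩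
  have hπ0 := Real.pi_gt_three
  have h1 : cosSum 1 w 0 + 1 / (2 * w) - 1 / 8
      = -(4 * π ^ 2 / w ^ 2 * (lambert 1 (2 * π ^ 2 / w) - lambert 1 (4 * π ^ 2 / w))) := by
    have := tsum_neg_one_pow_lambert_one_eq hw
    simp only [cosSum, mul_zero, Complex.cos_zero, mul_one, pow_one]
    rw [this]
    ring
  have e2 : (2 * π ^ 2 / w : ℂ).re = 2 * π ^ 2 * (w⁻¹).re := by
    rw [show (2 * π ^ 2 / w : ℂ) = ((2 * π ^ 2 : ℝ) : ℂ) * w⁻¹ by push_cast; ring,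
      Complex.re_ofReal_mul]
  have e4 : (4 * π ^ 2 / w : ℂ).re = 4 * π ^ 2 * (w⁻¹).re := by
    rw [show (4 * π ^ 2 / w : ℂ) = ((4 * π ^ 2 : ℝ) : ℂ) * w⁻¹ by push_cast; ring,
      Complex.re_ofReal_mul]
  have hY2 : 1 ≤ 2 * π ^ 2 * (w⁻¹).re := by nlinarith
  have b2 := hK (2 * π ^ 2 / w) (by rw [e2]; exact hY2)
  have b4 := hK (4 * π ^ 2 / w) (by rw [e4]; linarith)
  rw [e2] at b2
  rw [e4] at b4
  have b4' : ‖lambert 1 (4 * π ^ 2 / w)‖ ≤ K * Real.exp (-(2 * π ^ 2 * (w⁻¹).re)) := by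
    refine b4.trans (mul_le_mul_of_nonneg_left (Real.exp_le_exp.2 (by linarith)) hK0)
  have h2 := (norm_sub_le (lambert 1 (2 * π ^ 2 / w)) (lambert 1 (4 * π ^ 2 / w))).trans
    (add_le_add b2 b4')
  have h3 : ‖(4 * π ^ 2 / w ^ 2 : ℂ)‖ = 4 * π ^ 2 * ‖w‖⁻¹ ^ 2 := by
    rw [norm_div, norm_mul, norm_pow, norm_pow, Complex.norm_real,
      Real.norm_of_nonneg Real.pi_pos.le, Complex.norm_ofNat, inv_pow, div_eq_mul_inv]
  rw [h1, norm_neg, norm_mul, h3]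
  refine (mul_le_mul_of_nonneg_left h2 (by positivity)).trans_eq ?_
  ring

/-- Uniform expansions of the boundary series, with exponentially small remainders. -/
theorem norm_boundary_remainders_le : ∃ K : ℝ, 0 ≤ K ∧ ∀ (w a : ℂ) (M : ℝ),
    2 * |a.im| < w.re → 2 * ‖a‖ < M * ‖w‖ → ‖a‖ < 1 → M + 1 ≤ π * (w⁻¹).re →
    ‖sinSum 2 w a + Complex.tan a / (8 * Complex.cos a ^ 2)‖
      ≤ K * Real.exp (2 * π * M) * (‖w‖⁻¹ ^ 2 + ‖w‖⁻¹ ^ 3)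
        * Real.exp (-(2 * π ^ 2 * (w⁻¹).re)) ∧
    ‖cosSum 1 w a + 1 / (2 * w) - 1 / (8 * Complex.cos a ^ 2)‖
      ≤ K * Real.exp (2 * π * M) * (‖w‖⁻¹ ^ 2 + ‖w‖⁻¹ ^ 3)
        * Real.exp (-(2 * π ^ 2 * (w⁻¹).re)) ∧
    ‖sinSum 0 w a + a / w - Complex.tan a / 4‖
      ≤ K * Real.exp (2 * π * M) * (‖w‖⁻¹ ^ 2 + ‖w‖⁻¹ ^ 3)
        * Real.exp (-(2 * π ^ 2 * (w⁻¹).re)) := by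
  obtain ⟨K₂, hK₂0, hK₂⟩ := norm_sinSum_two_add_le
  obtain ⟨K₁, hK₁0, hK₁⟩ := norm_cosSum_one_zero_le
  refine ⟨2 * (K₁ + 2 * K₂), by positivity, fun w a M ha hM ha1 hY => ?_⟩
  have hw : 0 < w.re := lt_of_le_of_lt (by positivity) ha
  have hwn : 0 < ‖w‖ := norm_pos_iff.2 (by rintro rfl; simp at hw)
  have hM0 : 0 ≤ M := by
    by_contra h
    have : M * ‖w‖ < 0 := mul_neg_of_neg_of_pos (not_le.1 h) hwn
    linarith [norm_nonneg a]
  set X := Real.exp (-(2 * π ^ 2 * (w⁻¹).re))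
  set eM := Real.exp (2 * π * M)
  have heM : 1 ≤ eM := Real.one_le_exp (by positivity)
  set W₂ := ‖w‖⁻¹ ^ 2
  set W₃ := ‖w‖⁻¹ ^ 3
  have hW₂ : 0 ≤ W₂ := by positivity
  have hW₃ : 0 ≤ W₃ := by positivity
  have hX : 0 ≤ X := (Real.exp_pos _).le
  -- A convex set containing 0 and a on which all hypotheses hold, so the mean value inequality
  -- applies along segments from 0. It lies in the unit ball, so integrating costs no extra factor.
  set s : Set ℂ := {b | b.im < w.re / 2} ∩ {b | -(w.re / 2) < b.im}
    ∩ (Metric.ball 0 (M * ‖w‖ / 2) ∩ Metric.ball 0 1) with hs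
  have hsc : Convex ℝ s :=
    ((convex_halfSpace_im_lt _).inter (convex_halfSpace_im_gt _)).inter
      ((convex_ball _ _).inter (convex_ball _ _))
  have hmem : ∀ b, b ∈ s ↔ 2 * |b.im| < w.re ∧ 2 * ‖b‖ < M * ‖w‖ ∧ ‖b‖ < 1 := by
    intro b
    simp only [hs, Set.mem_inter_iff, Set.mem_ofPred_eq, mem_ball_zero_iff]
    constructor
    · rintro ⟨⟨h1, h2⟩, h3, h4⟩
      have := abs_lt.2 ⟨h2, h1⟩
      exact ⟨by linarith, by linarith, h4⟩
    · rintro ⟨h1, h2, h3⟩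
      have := abs_lt.1 (by linarith : |b.im| < w.re / 2)
      exact ⟨⟨this.2, this.1⟩, by linarith, h3⟩
  have has : a ∈ s := (hmem a).2 ⟨ha, hM, ha1⟩
  have h0s : (0 : ℂ) ∈ s :=
    (hmem 0).2 ⟨by simpa using hw, by
      rw [norm_zero, mul_zero]; exact lt_of_le_of_lt (by positivity) hM, by simp⟩
  have B2 : ∀ b ∈ s, ‖sinSum 2 w b + Complex.tan b / (8 * Complex.cos b ^ 2)‖
      ≤ K₂ * eM * W₃ * X := fun b hb =>
    hK₂ w b M ((hmem b).1 hb).1 ((hmem b).1 hb).2.1 ((hmem b).1 hb).2.2 hY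
  -- The derivative of the C₁ remainder is -2 times the S₂ remainder, since the derivative of 1/(8
  -- cos²) is tan/(4 cos²).
  have D1 : ∀ b ∈ s, HasDerivAt
      (fun b => cosSum 1 w b + 1 / (2 * w) - 1 / (8 * Complex.cos b ^ 2))
      (-2 * (sinSum 2 w b + Complex.tan b / (8 * Complex.cos b ^ 2))) b := by
    intro b hb
    have hcos := cos_ne_zero_of_norm_lt_one ((hmem b).1 hb).2.2
    have h1 := (((Complex.hasDerivAt_cos b).fun_pow 2).const_mul 8).fun_inv
      (by simpa using hcos : 8 * Complex.cos b ^ 2 ≠ 0)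
    simp_rw [one_div (8 * Complex.cos _ ^ 2)]
    refine (((hasDerivAt_cosSum 1 ((hmem b).1 hb).1).add_const _).sub h1).congr_deriv ?_
    rw [Complex.tan]
    push_cast
    field_simp
    ring
  have B1 : ∀ b ∈ s, ‖cosSum 1 w b + 1 / (2 * w) - 1 / (8 * Complex.cos b ^ 2)‖
      ≤ (K₁ * W₂ + 2 * (K₂ * eM * W₃)) * X := by
    intro b hb
    have h1 := hsc.norm_image_sub_le_of_norm_hasDerivWithin_le
      (fun b hb => (D1 b hb).hasDerivWithinAt) (C := 2 * (K₂ * eM * W₃ * X))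
      (fun b hb => by
        rw [norm_mul, norm_neg, Complex.norm_ofNat]
        exact mul_le_mul_of_nonneg_left (B2 b hb) (by norm_num)) h0s hb
    have h2 := hK₁ w hw (by linarith)
    rw [sub_zero, Complex.cos_zero, one_pow, mul_one] at h1
    have h3 := norm_le_norm_add_norm_sub'
      (cosSum 1 w b + 1 / (2 * w) - 1 / (8 * Complex.cos b ^ 2))
      (cosSum 1 w 0 + 1 / (2 * w) - 1 / 8)
    have h4 : 2 * (K₂ * eM * W₃ * X) * ‖b‖ ≤ 2 * (K₂ * eM * W₃ * X) :=
      mul_le_of_le_one_right (by positivity) ((hmem b).1 hb).2.2.le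
    linarith
  have D0 : ∀ b ∈ s, HasDerivAt (fun b => sinSum 0 w b + b / w - Complex.tan b / 4)
      (2 * (cosSum 1 w b + 1 / (2 * w) - 1 / (8 * Complex.cos b ^ 2))) b := by
    intro b hb
    have hcos := cos_ne_zero_of_norm_lt_one ((hmem b).1 hb).2.2
    refine (((hasDerivAt_sinSum 0 ((hmem b).1 hb).1).add ((hasDerivAt_id b).div_const w)).sub
      ((Complex.hasDerivAt_tan hcos).div_const 4)).congr_deriv ?_
    field_simp
    ring
  have B0 : ‖sinSum 0 w a + a / w - Complex.tan a / 4‖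
      ≤ 2 * ((K₁ * W₂ + 2 * (K₂ * eM * W₃)) * X) := by
    have h1 := hsc.norm_image_sub_le_of_norm_hasDerivWithin_le
      (fun b hb => (D0 b hb).hasDerivWithinAt)
      (C := 2 * ((K₁ * W₂ + 2 * (K₂ * eM * W₃)) * X))
      (fun b hb => by
        rw [norm_mul, Complex.norm_ofNat]
        exact mul_le_mul_of_nonneg_left (B1 b hb) (by norm_num)) h0s has
    -- S₀ vanishes at a = 0, so the second integration needs no constant.
    have h2 : sinSum 0 w 0 = 0 := by simp [sinSum]
    rw [h2, Complex.tan_zero] at h1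
    simp only [zero_div, add_zero, sub_zero] at h1
    exact h1.trans (mul_le_of_le_one_right (by positivity) ha1.le)
  have hcmp : (K₁ * W₂ + 2 * (K₂ * eM * W₃)) ≤ (K₁ + 2 * K₂) * eM * (W₂ + W₃) := by
    have h1 : K₁ * W₂ ≤ K₁ * eM * W₂ := by
      have := mul_le_mul_of_nonneg_left heM (by positivity : 0 ≤ K₁ * W₂)
      linarith
    have h2 : 0 ≤ K₁ * eM * W₃ := by positivity
    have h3 : 0 ≤ K₂ * eM * W₂ := by positivity
    linarith
  have hcmpX := mul_le_mul_of_nonneg_right hcmp hX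
  have hnn : 0 ≤ (K₁ * W₂ + 2 * (K₂ * eM * W₃)) * X := by positivity
  have hnn2 : 0 ≤ K₁ * W₂ * X := by positivity
  have hnn3 : 0 ≤ K₂ * eM * W₃ * X := by positivity
  refine ⟨(B2 a has).trans ?_, (B1 a has).trans ?_, B0.trans ?_⟩ <;> linarith

end AdSDistillate

namespace AdSDistillate

/-! ### The domain near the origin -/

open Complex (exp I)
open scoped Real

theorem root_re_pos {z : ℂ} (hz : z ∈ Complex.slitPlane) : 0 < (root z).re := by
  have hz0 := Complex.slitPlane_ne_zero hz
  have harg := Complex.mem_slitPlane_iff_arg.1 hz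
  have h1 := Complex.neg_pi_lt_arg z
  have h2 := lt_of_le_of_ne (Complex.arg_le_pi z) harg.1
  rw [root, Complex.cpow_def_of_ne_zero hz0, Complex.exp_re]
  refine mul_pos (Real.exp_pos _) (Real.cos_pos_of_mem_Ioo ⟨?_, ?_⟩)
  all_goals
    rw [show Complex.log z * (1 / 2) = ((1 / 2 : ℝ) : ℂ) * Complex.log z by push_cast; ring,
      Complex.im_ofReal_mul, Complex.log_im]
    linarith

/-! ### Convergence of S₂ restricts the domain. -/

theorem le_norm_sin (z : ℂ) :
    (Real.exp |z.im| - Real.exp (-|z.im|)) / 2 ≤ ‖Complex.sin z‖ := by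
  have h1 : ‖exp (-z * I)‖ = Real.exp z.im := by
    rw [Complex.norm_exp]
    simp
  have h2 : ‖exp (z * I)‖ = Real.exp (-z.im) := by
    rw [Complex.norm_exp]
    simp
  rw [Complex.sin, norm_div, norm_mul, Complex.norm_I, mul_one, Complex.norm_ofNat]
  have h3 := abs_norm_sub_norm_le (exp (-z * I)) (exp (z * I))
  rw [h1, h2] at h3
  rcases le_total 0 z.im with h | h
  · rw [abs_of_nonneg h]
    have := (le_abs_self _).trans h3
    linarith
  · rw [abs_of_nonpos h, neg_neg]
    have := (neg_le_abs _).trans h3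
    linarith

/-- Otherwise the sine grows at least like sinh((n+1) Re w), which is comparable with the
denominator, and the terms stay away from zero. -/
theorem two_mul_abs_im_lt_of_summable {w a : ℂ} (hw : 0 < w.re)
    (hs : Summable fun n : ℕ => ((n : ℂ) + 1) ^ 2 * (-1) ^ (n + 1)
      / (exp (((n : ℂ) + 1) * w) - 1) * Complex.sin (2 * ((n : ℂ) + 1) * a)) :
    2 * |a.im| < w.re := by
  by_contra! hle
  have hx : Real.exp (-w.re) < 1 := by simpa using hw
  have hlow : ∀ n : ℕ, (1 - Real.exp (-w.re)) / 2 ≤ ‖((n : ℂ) + 1) ^ 2 * (-1) ^ (n + 1)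
      / (exp (((n : ℂ) + 1) * w) - 1) * Complex.sin (2 * ((n : ℂ) + 1) * a)‖ := by
    intro n
    have h1 : ‖(n : ℂ) + 1‖ = (n : ℝ) + 1 := by exact_mod_cast Complex.norm_natCast (n + 1)
    rw [norm_mul, norm_div, norm_mul, norm_pow, norm_pow, norm_neg, norm_one, one_pow, h1, mul_one]
    set s := ((n : ℝ) + 1) * w.re with hs
    have hs0 : 0 < s := by positivity
    have h2 : ‖exp (((n : ℂ) + 1) * w) - 1‖ ≤ Real.exp s + 1 := by
      refine (norm_sub_le _ _).trans_eq ?_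
      rw [Complex.norm_exp, norm_one]
      simp [hs]
    have h3 : Real.exp s - 1 ≤ ‖exp (((n : ℂ) + 1) * w) - 1‖ := by
      have := norm_sub_norm_le (exp (((n : ℂ) + 1) * w)) 1
      rw [Complex.norm_exp, norm_one] at this
      simpa [hs] using this
    have h4 : 0 < ‖exp (((n : ℂ) + 1) * w) - 1‖ := by
      have : 1 < Real.exp s := by simpa using hs0
      linarith
    have h5 : (Real.exp s - Real.exp (-s)) / 2 ≤ ‖Complex.sin (2 * ((n : ℂ) + 1) * a)‖ := by
      refine le_trans ?_ (le_norm_sin _)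
      rw [abs_im_two_mul_natCast_mul]
      have h6 : s ≤ ((n : ℝ) + 1) * (2 * |a.im|) := mul_le_mul_of_nonneg_left hle (by positivity)
      have h7 := Real.exp_le_exp.2 h6
      have h8 := Real.exp_le_exp.2 (neg_le_neg h6)
      linarith
    -- Equality would hold with e^{-s} in place of e^{-Re w}, because (1 - e^{-s})(e^s + 1) = e^s -
    -- e^{-s}.
    have h6 : (1 - Real.exp (-w.re)) / 2 * (Real.exp s + 1) ≤ (Real.exp s - Real.exp (-s)) / 2 := by
      have h7 : Real.exp (-s) ≤ Real.exp (-w.re) := by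
        refine Real.exp_le_exp.2 ?_
        have : 0 ≤ (n : ℝ) * w.re := by positivity
        linarith
      have h8 : Real.exp s * Real.exp (-s) = 1 := by rw [← Real.exp_add]; simp
      have h9 := mul_le_mul_of_nonneg_right h7 (by positivity : 0 ≤ Real.exp s + 1)
      nlinarith
    rw [div_mul_eq_mul_div, le_div_iff₀ h4]
    have h7 : (1 - Real.exp (-w.re)) / 2 * ‖exp (((n : ℂ) + 1) * w) - 1‖
        ≤ (1 - Real.exp (-w.re)) / 2 * (Real.exp s + 1) :=
      mul_le_mul_of_nonneg_left h2 (by linarith)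
    have h8 : 1 ≤ ((n : ℝ) + 1) ^ 2 := one_le_pow₀ (by linarith [n.cast_nonneg (α := ℝ)])
    have h9 := mul_le_mul_of_nonneg_right h8 (norm_nonneg (Complex.sin (2 * ((n : ℂ) + 1) * a)))
    linarith
  have := ge_of_tendsto hs.tendsto_atTop_zero.norm (Eventually.of_forall hlow)
  rw [norm_zero] at this
  linarith

theorem summable_coeff_mul (m : ℕ) {w a : ℂ} (ha : 2 * |a.im| < w.re) {φ : ℂ → ℂ}
    (hb : ∀ z, ‖φ z‖ ≤ Real.exp |z.im|) :
    Summable fun n : ℕ => ((n : ℂ) + 1) ^ m * (-1) ^ (n + 1)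
        / (exp (((n : ℂ) + 1) * w) - 1) * φ (2 * ((n : ℂ) + 1) * a) := by
  have hw : 0 < w.re := lt_of_le_of_lt (by positivity) ha
  refine Summable.of_norm_bounded (((summable_pow_mul_exp_neg m (sub_pos.2 ha))).mul_left
    (1 - Real.exp (-w.re))⁻¹) fun n => ?_
  rw [norm_mul]
  have h1 : ‖φ (2 * ((n : ℂ) + 1) * a)‖ ≤ Real.exp (((n : ℝ) + 1) * (2 * |a.im|)) := by
    rw [← abs_im_two_mul_natCast_mul]
    exact hb _
  refine (mul_le_mul (norm_coeff_le m hw n) h1 (norm_nonneg _)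
    ((norm_nonneg _).trans (norm_coeff_le m hw n))).trans_eq ?_
  rw [mul_assoc, mul_assoc, ← Real.exp_add]
  ring_nf

theorem ofReal_mem_domain {T₀ t : ℝ} (r : ℝ) (hT : 0 < T₀) (ht : 0 < t) :
    (t : ℂ) ∈ domain T₀ r := by
  have hroot : root t = ((t ^ (1 / 2 : ℝ) : ℝ) : ℂ) := by
    rw [root, Complex.ofReal_cpow ht.le]
    norm_num
  have hk : 0 < t ^ (1 / 2 : ℝ) := Real.rpow_pos_of_pos ht _
  have hre : 0 < (root t * ((1 / T₀ : ℝ) : ℂ)).re := by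
    rw [hroot, ← Complex.ofReal_mul, Complex.ofReal_re]
    positivity
  have ha : 2 * |(Complex.arctan (root t * (r : ℂ))).im|
      < (root t * ((1 / T₀ : ℝ) : ℂ)).re := by
    rw [hroot, ← Complex.ofReal_mul, ← Complex.ofReal_arctan, Complex.ofReal_im, abs_zero,
      mul_zero, ← hroot]
    exact hre
  refine ⟨Complex.ofReal_mem_slitPlane.2 ht, summable_lambert 3 hre,
    summable_coeff_mul 0 ha norm_sin_le_exp_abs_im,
    summable_coeff_mul 1 ha norm_cos_le_exp_abs_im, summable_coeff_mul 2 ha norm_sin_le_exp_abs_im⟩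

theorem zero_mem_closure_domain {T₀ : ℝ} (r : ℝ) (hT : 0 < T₀) :
    (0 : ℂ) ∈ closure (domain T₀ r \ {0}) := by
  have h : Tendsto (fun t : ℝ => (t : ℂ)) (𝓝[>] 0) (𝓝 0) := by
    have := (Complex.continuous_ofReal.tendsto 0).mono_left (nhdsWithin_le_nhds (s := Set.Ioi 0))
    simpa using this
  refine mem_closure_of_tendsto h ?_
  filter_upwards [self_mem_nhdsWithin] with t ht
  exact ⟨ofReal_mem_domain r hT ht, by simpa using (ne_of_gt ht : t ≠ 0)⟩

theorem hasDerivAt_arctan_zero : HasDerivAt Complex.arctan 1 0 := by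
  have h1 : HasDerivAt (fun z : ℂ => 1 + z * I) I 0 := by
    simpa using ((hasDerivAt_id (0 : ℂ)).mul_const I).const_add 1
  have h2 : HasDerivAt (fun z : ℂ => 1 - z * I) (-I) 0 := by
    simpa using ((hasDerivAt_id (0 : ℂ)).mul_const I).const_sub 1
  have h3 := ((h1.fun_div h2 (by simp)).clog (by simp)).const_mul (-I / 2)
  refine h3.congr_deriv ?_
  simp only [zero_mul, add_zero, sub_zero, mul_one, one_mul, one_pow, div_one]
  linear_combination -Complex.I_sq

theorem eventually_norm_arctan_sub_le : ∀ᶠ u : ℂ in 𝓝 0, ‖Complex.arctan u - u‖ ≤ 1 / 2 * ‖u‖ := by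
  have h := hasDerivAt_arctan_zero
  have h2 := isLittleO_iff.1 (hasDerivAt_iff_isLittleO_nhds_zero.1 h) (by norm_num : (0 : ℝ) < 1 / 2)
  filter_upwards [h2] with u hu
  simpa [Complex.arctan] using hu

theorem two_mul_abs_im_lt_of_mem_domain {T₀ r : ℝ} (hT : 0 < T₀) {z : ℂ} (hz : z ∈ domain T₀ r) :
    2 * |(Complex.arctan (root z * (r : ℂ))).im| < (root z * ((1 / T₀ : ℝ) : ℂ)).re := by
  obtain ⟨h1, -, -, -, h2⟩ := hz
  refine two_mul_abs_im_lt_of_summable ?_ h2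
  rw [Complex.re_mul_ofReal]
  exact mul_pos (root_re_pos h1) (by positivity)

/-- Near the origin the domain lies in a closed subsector of `Re κ > 0`. -/
theorem eventually_domain_sector {T₀ r : ℝ} (hT : 0 < T₀) (hr : 0 < r) :
    ∃ c : ℝ, 0 < c ∧ ∀ᶠ z in 𝓝[domain T₀ r \ {0}] 0, c * ‖root z‖ ≤ (root z).re := by
  have hT' : 0 < 1 / T₀ := by positivity
  set β := 1 / T₀ with hβ
  -- The constant comes from |κ| ≤ Re κ + |Im κ| ≤ (1 + β/2r) Re κ + |κ|/2, the half being the error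
  -- of arctan u ≈ u.
  refine ⟨(2 * (1 + β / (2 * r)))⁻¹, by positivity, ?_⟩
  have hlim : Tendsto (fun z => root z * (r : ℂ)) (𝓝[domain T₀ r \ {0}] 0) (𝓝 0) := by
    have := tendsto_root.mul_const (r : ℂ)
    rw [zero_mul] at this
    exact this.mono_left nhdsWithin_le_nhds
  filter_upwards [hlim.eventually eventually_norm_arctan_sub_le, self_mem_nhdsWithin] with z h1 h2
  have h3 := two_mul_abs_im_lt_of_mem_domain hT h2.1
  rw [Complex.re_mul_ofReal] at h3
  have h4 := Complex.abs_im_le_norm (Complex.arctan (root z * r) - root z * r)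
  rw [Complex.sub_im, Complex.im_mul_ofReal] at h4
  rw [norm_mul, Complex.norm_real, Real.norm_of_nonneg hr.le] at h1
  have h5 : |(root z).im| * r = |(root z).im * r| := by rw [abs_mul, abs_of_pos hr]
  have h6 := abs_sub_abs_le_abs_sub ((root z).im * r) (Complex.arctan (root z * r)).im
  rw [abs_sub_comm] at h6
  have h7 := Complex.norm_le_abs_re_add_abs_im (root z)
  rw [abs_of_pos (root_re_pos h2.1.1)] at h7
  have h8 : |(root z).im| * r ≤ (root z).re * β / 2 + 1 / 2 * (‖root z‖ * r) := by linarith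
  have h9 : |(root z).im| ≤ (root z).re * β / (2 * r) + 1 / 2 * ‖root z‖ := by
    refine le_of_mul_le_mul_right (h8.trans_eq ?_) hr
    field_simp
  rw [inv_mul_le_iff₀ (by positivity)]
  have h10 : (root z).re * β / (2 * r) = β / (2 * r) * (root z).re := by ring
  linarith

/-! ### Remainders smaller than every power of κ in a sector. -/

theorem exp_neg_mul_re_inv_le {c β C : ℝ} (hc : 0 < c) (hβ : 0 < β) (hC : 0 < C) (n : ℕ) {κ : ℂ}
    (hκ : κ ≠ 0) (h : c * ‖κ‖ ≤ κ.re) :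
    Real.exp (-(C * ((κ * (β : ℂ))⁻¹).re)) ≤ n.factorial / (C * c / β) ^ n * ‖κ‖ ^ n := by
  have hn : 0 < ‖κ‖ := norm_pos_iff.2 hκ
  have h1 : C * c / β / ‖κ‖ ≤ C * ((κ * (β : ℂ))⁻¹).re := by
    have : ((κ * (β : ℂ))⁻¹).re = κ.re / ‖κ‖ ^ 2 / β := by
      rw [mul_inv, ← Complex.ofReal_inv, Complex.re_mul_ofReal, Complex.inv_re,
        Complex.normSq_eq_norm_sq]
      rfl
    rw [this]
    have h2 : c / ‖κ‖ ≤ κ.re / ‖κ‖ ^ 2 := by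
      rw [div_le_div_iff₀ hn (by positivity)]
      nlinarith
    calc C * c / β / ‖κ‖ = C * (c / ‖κ‖ / β) := by field_simp
      _ ≤ _ := by gcongr
  have hx : 0 < C * c / β / ‖κ‖ := by positivity
  -- In the sector Re(1/κ) ≥ c/|κ|, and xⁿ/n! ≤ eˣ converts exponential decay into any power.
  have h3 := Real.pow_div_factorial_le_exp _ hx.le n
  have h4 : Real.exp (-(C * ((κ * (β : ℂ))⁻¹).re)) ≤ (Real.exp (C * c / β / ‖κ‖))⁻¹ := by
    rw [← Real.exp_neg]
    exact Real.exp_le_exp.2 (neg_le_neg h1)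
  refine h4.trans ((inv_anti₀ (by positivity) h3).trans_eq ?_)
  rw [inv_div, div_pow _ ‖κ‖, div_div_eq_mul_div, div_mul_eq_mul_div]

theorem le_re_inv {c β X : ℝ} (hβ : 0 < β) (hX : 0 < X) {κ : ℂ}
    (hκ : κ ≠ 0) (h : c * ‖κ‖ ≤ κ.re) (hρ : ‖κ‖ < c / (β * X)) :
    X ≤ ((κ * (β : ℂ))⁻¹).re := by
  have hn : 0 < ‖κ‖ := norm_pos_iff.2 hκ
  have : ((κ * (β : ℂ))⁻¹).re = κ.re / ‖κ‖ ^ 2 / β := by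
    rw [mul_inv, ← Complex.ofReal_inv, Complex.re_mul_ofReal, Complex.inv_re,
      Complex.normSq_eq_norm_sq]
    rfl
  rw [this, le_div_iff₀ hβ, le_div_iff₀ (by positivity)]
  rw [lt_div_iff₀ (by positivity)] at hρ
  nlinarith

theorem f3_remainder {β c : ℝ} (hβ : 0 < β) (hc : 0 < c) (N : ℕ) :
    ∃ K ρ : ℝ, 0 < ρ ∧ ∀ κ : ℂ, κ ≠ 0 → ‖κ‖ < ρ → c * ‖κ‖ ≤ κ.re →
      ‖f3 (κ * (β : ℂ)) - π ^ 4 / (15 * (κ * (β : ℂ)) ^ 4) + 1 / 240‖ ≤ K * ‖κ‖ ^ N := by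
  obtain ⟨K, hK0, hK⟩ := norm_lambert_le 3
  have hπ0 := Real.pi_gt_three
  -- Order N + 4 compensates the factor κ⁻⁴ of the modular transformation.
  refine ⟨16 * π ^ 4 / β ^ 4 * (K * ((N + 4).factorial / (4 * π ^ 2 * c / β) ^ (N + 4))),
    c / (β * 1), by positivity, fun κ hκ hρ h => ?_⟩
  have hn : 0 < ‖κ‖ := norm_pos_iff.2 hκ
  have hre : 0 < (κ * (β : ℂ)).re := by
    rw [Complex.re_mul_ofReal]
    exact mul_pos (lt_of_lt_of_le (by positivity) h) hβ
  have h1 := le_re_inv hβ one_pos hκ h hρ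
  have e4 : (4 * π ^ 2 / (κ * β) : ℂ).re = 4 * π ^ 2 * ((κ * (β : ℂ))⁻¹).re := by
    rw [show (4 * π ^ 2 / (κ * β) : ℂ) = ((4 * π ^ 2 : ℝ) : ℂ) * (κ * β)⁻¹ by push_cast; ring,
      Complex.re_ofReal_mul]
  have h2 : 1 ≤ (4 * π ^ 2 / (κ * β) : ℂ).re := by
    rw [e4]
    nlinarith
  have h3 := hK _ h2
  rw [e4] at h3
  have h4 := exp_neg_mul_re_inv_le hc hβ (by positivity : 0 < 4 * π ^ 2) (N + 4) hκ h
  rw [f3_eq_lambert, lambert_three hre, sub_add_eq_add_sub]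
  have h5 : (π ^ 4 / (15 * (κ * (β : ℂ)) ^ 4) - 1 / 240
      + 16 * π ^ 4 / (κ * (β : ℂ)) ^ 4 * lambert 3 (4 * π ^ 2 / (κ * β)) + 1 / 240
        - π ^ 4 / (15 * (κ * (β : ℂ)) ^ 4))
      = 16 * π ^ 4 / (κ * (β : ℂ)) ^ 4 * lambert 3 (4 * π ^ 2 / (κ * β)) := by ring
  rw [h5, norm_mul]
  have h6 : ‖(16 * π ^ 4 / (κ * (β : ℂ)) ^ 4 : ℂ)‖ = 16 * π ^ 4 / β ^ 4 / ‖κ‖ ^ 4 := by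
    rw [norm_div, norm_mul, norm_pow, norm_pow, norm_mul, Complex.norm_real, Complex.norm_real,
      Real.norm_of_nonneg Real.pi_pos.le, Real.norm_of_nonneg hβ.le, Complex.norm_ofNat]
    field_simp
  rw [h6]
  calc 16 * π ^ 4 / β ^ 4 / ‖κ‖ ^ 4 * ‖lambert 3 (4 * π ^ 2 / (κ * β))‖
      ≤ 16 * π ^ 4 / β ^ 4 / ‖κ‖ ^ 4
        * (K * ((N + 4).factorial / (4 * π ^ 2 * c / β) ^ (N + 4) * ‖κ‖ ^ (N + 4))) := by
        gcongr
        exact h3.trans (mul_le_mul_of_nonneg_left h4 hK0)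
    _ = _ := by
        rw [pow_add ‖κ‖]
        field_simp

theorem boundary_remainders {β c r : ℝ} (hβ : 0 < β) (hc : 0 < c) (hr : 0 < r) (N : ℕ) :
    ∃ K ρ : ℝ, 0 < ρ ∧ ∀ κ : ℂ, κ ≠ 0 → ‖κ‖ < ρ → c * ‖κ‖ ≤ κ.re →
      2 * |(Complex.arctan (κ * (r : ℂ))).im| < (κ * (β : ℂ)).re →
      ‖sinSeries 2 κ β r + κ * r * (1 + κ ^ 2 * r ^ 2) / 8‖ ≤ K * ‖κ‖ ^ N ∧
      ‖cosSeries 1 κ β r + 1 / (2 * (κ * β)) - (1 + κ ^ 2 * r ^ 2) / 8‖ ≤ K * ‖κ‖ ^ N ∧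
      ‖sinSeries 0 κ β r + Complex.arctan (κ * r) / (κ * β) - κ * r / 4‖ ≤ K * ‖κ‖ ^ N := by
  obtain ⟨K, hK0, hK⟩ := norm_boundary_remainders_le
  have hπ0 := Real.pi_gt_three
  obtain ⟨ρ₁, hρ₁, hb⟩ := Metric.eventually_nhds_iff.1 eventually_norm_arctan_sub_le
  -- Near 0, 2|a| ≤ 3|κ|r < 4|κ|r = M|w|.
  set M := 4 * r / β with hM
  have hM0 : 0 < M := by positivity
  set F := (N + 3).factorial / (2 * π ^ 2 * c / β) ^ (N + 3) with hF
  have hF0 : 0 < F := by positivity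
  -- The radii secure, in turn, arctan u ≈ u, largeness of Re(1/w), |κr| < 1/2 (so κr ≠ ±i and |a| <
  -- 1), and |κ|⁻² ≤ |κ|⁻³.
  refine ⟨K * Real.exp (2 * π * M) * ((β⁻¹) ^ 2 + (β⁻¹) ^ 3) * F,
    min (min (ρ₁ / r) (c / (β * (M + 1)))) (min (1 / (2 * r)) 1), by positivity,
    fun κ hκ hρ h ha => ?_⟩
  obtain ⟨⟨hρa, hρb⟩, hρc, hρd⟩ : (‖κ‖ < ρ₁ / r ∧ ‖κ‖ < c / (β * (M + 1)))
      ∧ ‖κ‖ < 1 / (2 * r) ∧ ‖κ‖ < 1 := by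
    simpa only [lt_min_iff] using hρ
  have hn : 0 < ‖κ‖ := norm_pos_iff.2 hκ
  have hκr : ‖κ * (r : ℂ)‖ = ‖κ‖ * r := by
    rw [norm_mul, Complex.norm_real, Real.norm_of_nonneg hr.le]
  have hκβ : ‖κ * (β : ℂ)‖ = ‖κ‖ * β := by
    rw [norm_mul, Complex.norm_real, Real.norm_of_nonneg hβ.le]
  have h1 : ‖κ‖ * r < ρ₁ := (lt_div_iff₀ hr).1 hρa
  have h2 : ‖κ‖ * r < 1 / 2 := by
    have := mul_lt_mul_of_pos_right hρc hr
    rwa [show 1 / (2 * r) * r = 1 / 2 by field_simp] at this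
  have h3 := hb (y := κ * (r : ℂ)) (by rw [dist_zero_right, hκr]; exact h1)
  rw [hκr] at h3
  have h4 : ‖Complex.arctan (κ * r)‖ ≤ 3 / 2 * (‖κ‖ * r) := by
    have := norm_le_norm_add_norm_sub' (Complex.arctan (κ * r)) (κ * r)
    rw [hκr] at this
    linarith
  have hκrpos : 0 < ‖κ‖ * r := by positivity
  have hI : ∀ s : ℂ, ‖s‖ = 1 → κ * (r : ℂ) ≠ s := by
    rintro s hs rfl
    rw [hκr] at hs
    linarith
  set a := Complex.arctan (κ * r) with hadef
  have htan : Complex.tan a = κ * r :=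
    Complex.tan_arctan (hI _ (by simp)) (hI _ (by simp))
  have ha1 : ‖a‖ < 1 := by linarith
  have hcos := cos_ne_zero_of_norm_lt_one ha1
  have hcos2 : (Complex.cos a ^ 2)⁻¹ = 1 + κ ^ 2 * r ^ 2 := by
    rw [← mul_pow, ← htan, Complex.tan]
    have := Complex.sin_sq_add_cos_sq a
    field_simp
    rw [add_comm]
    exact this.symm
  have hMM : 2 * ‖a‖ < M * ‖κ * (β : ℂ)‖ := by
    rw [hκβ, hM, show 4 * r / β * (‖κ‖ * β) = 4 * (‖κ‖ * r) by field_simp]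
    linarith
  have hY : M + 1 ≤ π * ((κ * (β : ℂ))⁻¹).re := by
    have := le_re_inv hβ (by positivity : 0 < M + 1) hκ h hρb
    nlinarith
  have hfin : K * Real.exp (2 * π * M) * (‖κ * (β : ℂ)‖⁻¹ ^ 2 + ‖κ * (β : ℂ)‖⁻¹ ^ 3)
        * Real.exp (-(2 * π ^ 2 * ((κ * (β : ℂ))⁻¹).re))
      ≤ K * Real.exp (2 * π * M) * ((β⁻¹) ^ 2 + (β⁻¹) ^ 3) * F * ‖κ‖ ^ N := by
    have h5 := exp_neg_mul_re_inv_le hc hβ (by positivity : 0 < 2 * π ^ 2) (N + 3) hκ h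
    have h6 : ‖κ * (β : ℂ)‖⁻¹ ^ 2 + ‖κ * (β : ℂ)‖⁻¹ ^ 3
        ≤ ((β⁻¹) ^ 2 + (β⁻¹) ^ 3) * ‖κ‖⁻¹ ^ 3 := by
      rw [hκβ, mul_inv, mul_pow, mul_pow]
      have : ‖κ‖⁻¹ ^ 2 ≤ ‖κ‖⁻¹ ^ 3 :=
        pow_le_pow_right₀ ((one_le_inv₀ hn).2 hρd.le) (by norm_num)
      have := mul_le_mul_of_nonneg_right this (by positivity : 0 ≤ (β⁻¹) ^ 2)
      linarith
    calc _ ≤ K * Real.exp (2 * π * M) * (((β⁻¹) ^ 2 + (β⁻¹) ^ 3) * ‖κ‖⁻¹ ^ 3)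
        * (F * ‖κ‖ ^ (N + 3)) := by gcongr
      _ = _ := by
        rw [pow_add ‖κ‖]
        field_simp
  obtain ⟨r2, r1, r0⟩ := hK (κ * (β : ℂ)) a M ha hMM ha1 hY
  have e2 : sinSeries 2 κ β r + κ * r * (1 + κ ^ 2 * r ^ 2) / 8
      = sinSum 2 (κ * β) a + Complex.tan a / (8 * Complex.cos a ^ 2) := by
    rw [← hcos2, htan]
    change sinSum 2 (κ * β) a + _ = _
    field_simp
  have e1 : cosSeries 1 κ β r + 1 / (2 * (κ * β)) - (1 + κ ^ 2 * r ^ 2) / 8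
      = cosSum 1 (κ * β) a + 1 / (2 * (κ * β)) - 1 / (8 * Complex.cos a ^ 2) := by
    rw [← hcos2]
    change cosSum 1 (κ * β) a + _ - _ = _
    field_simp
  have e0 : sinSeries 0 κ β r + a / (κ * β) - κ * r / 4
      = sinSum 0 (κ * β) a + a / (κ * β) - Complex.tan a / 4 := by
    rw [htan]
    rfl
  rw [e2, e1, e0]
  exact ⟨r2.trans hfin, r1.trans hfin, r0.trans hfin⟩

theorem isBigO_bulk_sector {β ε : ℝ} (hβ : 0 < β) (hε : 0 < ε) (N : ℕ) :
    (fun κ : ℂ => κ ^ 3 * f3 (κ * (β : ℂ))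
        - ((Real.pi : ℂ) ^ 4 / 15 * (1 / (κ * (β : ℂ) ^ 4)) - κ ^ 3 / 240))
      =O[𝓝[{κ : ℂ | κ ≠ 0 ∧ |κ.arg| ≤ Real.pi / 2 - ε}] 0] (fun κ : ℂ => ‖κ‖ ^ N) := by
  rcases lt_or_ge (π / 2) ε with hlt | hle
  · refine IsBigO.of_bound 1 ?_
    filter_upwards [self_mem_nhdsWithin] with κ hκ
    linarith [hκ.2, abs_nonneg κ.arg]
  · have hc : 0 < Real.sin ε := Real.sin_pos_of_pos_of_lt_pi hε (by linarith [Real.pi_pos])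
    obtain ⟨K, ρ, hρ, hK⟩ := f3_remainder hβ hc N
    refine IsBigO.of_bound K ?_
    filter_upwards [self_mem_nhdsWithin,
      nhdsWithin_le_nhds (Metric.ball_mem_nhds (0 : ℂ) (lt_min hρ one_pos))] with κ hκ hball
    rw [mem_ball_zero_iff, lt_min_iff] at hball
    have hre : Real.sin ε * ‖κ‖ ≤ κ.re := by
      rw [← Complex.norm_mul_cos_arg κ, mul_comm]
      refine mul_le_mul_of_nonneg_left ?_ (norm_nonneg _)
      rw [← Real.cos_pi_div_two_sub, ← Real.cos_abs κ.arg]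
      exact Real.cos_le_cos_of_nonneg_of_le_pi (abs_nonneg _) (by linarith [Real.pi_pos]) hκ.2
    have h1 := hK κ hκ.1 hball.1 hre
    have hκ0 := hκ.1
    have hβ0 : (β : ℂ) ≠ 0 := by exact_mod_cast hβ.ne'
    have e : κ ^ 3 * f3 (κ * (β : ℂ))
        - ((Real.pi : ℂ) ^ 4 / 15 * (1 / (κ * (β : ℂ) ^ 4)) - κ ^ 3 / 240)
        = κ ^ 3 * (f3 (κ * (β : ℂ)) - π ^ 4 / (15 * (κ * (β : ℂ)) ^ 4) + 1 / 240) := by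
      field_simp
      ring
    rw [e, norm_mul, norm_pow, Real.norm_of_nonneg (by positivity)]
    refine (mul_le_of_le_one_left (norm_nonneg _) (pow_le_one₀ (norm_nonneg _) hball.2.le)).trans h1

end AdSDistillate

namespace AdSDistillate

/-! ### The components of the stress-energy tensor near the origin -/

open Complex (exp I)
open scoped Real

theorem analyticAt_lapse (x : Fin 4 → ℝ) : AnalyticAt ℂ (fun z => lapse z x) 0 := by
  unfold lapse
  fun_prop

theorem lapse_zero (x : Fin 4 → ℝ) : lapse 0 x = 1 := by simp [lapse]

theorem analyticAt_lapse_inv (x : Fin 4 → ℝ) : AnalyticAt ℂ (fun z => (lapse z x)⁻¹) 0 :=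
  (analyticAt_lapse x).fun_inv (by simp [lapse_zero])

theorem analyticAt_diagonal {v : ℂ → Fin 4 → ℂ} (hv : ∀ μ, AnalyticAt ℂ (fun z => v z μ) 0)
    (μ ν : Fin 4) : AnalyticAt ℂ (fun z => Matrix.diagonal (v z) μ ν) 0 := by
  by_cases h : μ = ν
  · subst h
    simpa only [Matrix.diagonal_apply_eq] using hv μ
  · simp only [Matrix.diagonal_apply_ne _ h]
    exact analyticAt_const

theorem analyticAt_metric (x : Fin 4 → ℝ) (μ ν : Fin 4) :
    AnalyticAt ℂ (fun z => metric z x μ ν) 0 := by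
  simp only [metric_eq_lapse]
  refine analyticAt_diagonal (fun μ => ?_) μ ν
  fin_cases μ
  · exact analyticAt_lapse x
  · exact (analyticAt_lapse_inv x).fun_neg
  all_goals exact analyticAt_const

theorem analyticAt_radiationTensor (x : Fin 4 → ℝ) (μ ν : Fin 4) :
    AnalyticAt ℂ (fun z => radiationTensor z x μ ν) 0 := by
  simp only [radiationTensor_eq]
  refine analyticAt_diagonal (fun μ => ?_) μ ν
  fin_cases μ
  · exact analyticAt_const.fun_mul (analyticAt_lapse x)
  · exact analyticAt_lapse_inv x
  all_goals exact analyticAt_const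

theorem analyticAt_distilledTensor (T₀ : ℝ) (x : Fin 4 → ℝ) (μ ν : Fin 4) :
    AnalyticAt ℂ (fun z => distilledTensor T₀ z x μ ν) 0 := by
  have h : AnalyticAt ℂ (fun z : ℂ => (π : ℂ) ^ 2 / 90 * (T₀ : ℂ) ^ 4
      - z ^ 2 / (1440 * (π : ℂ) ^ 2)) 0 := by
    simp only [div_eq_mul_inv]
    fun_prop
  refine (h.fun_mul (AnalyticAt.fun_pow ?_ 2)).fun_mul (analyticAt_radiationTensor x μ ν)
  exact (analyticAt_lapse_inv x).congr (Eventually.of_forall fun z => (one_div _).symm)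

theorem analyticAt_arctan_zero : AnalyticAt ℂ Complex.arctan 0 := by
  have h : AnalyticAt ℂ (fun z : ℂ => (1 + z * I) / (1 - z * I)) 0 :=
    AnalyticAt.fun_div (by fun_prop) (by fun_prop) (by simp)
  exact analyticAt_const.fun_mul (h.clog (by simp))

theorem eventually_arctan_neg : ∀ᶠ z : ℂ in 𝓝 0, Complex.arctan (-z) = -Complex.arctan z := by
  filter_upwards [Metric.ball_mem_nhds (0 : ℂ) one_pos] with z hz
  rw [mem_ball_zero_iff] at hz
  refine (Complex.hasSum_arctan (z := -z) (by rwa [norm_neg])).unique ?_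
  refine (Complex.hasSum_arctan hz).neg.congr_fun fun n => ?_
  rw [Odd.neg_pow ⟨n, rfl⟩]
  ring

/-- The component `u_μ u_ν`. -/
noncomputable def velocitySq (z : ℂ) (x : Fin 4 → ℝ) (μ ν : Fin 4) : ℂ :=
  if μ = 0 ∧ ν = 0 then lapse z x else 0

/-- The component of the square of the normalized four-acceleration. -/
noncomputable def radialSq (z : ℂ) (x : Fin 4 → ℝ) (μ ν : Fin 4) : ℂ :=
  if μ = 1 ∧ ν = 1 then (lapse z x)⁻¹ else 0

theorem analyticAt_velocitySq (x : Fin 4 → ℝ) (μ ν : Fin 4) :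
    AnalyticAt ℂ (fun z => velocitySq z x μ ν) 0 := by
  unfold velocitySq
  split_ifs
  exacts [analyticAt_lapse x, analyticAt_const]

theorem analyticAt_radialSq (x : Fin 4 → ℝ) (μ ν : Fin 4) :
    AnalyticAt ℂ (fun z => radialSq z x μ ν) 0 := by
  unfold radialSq
  split_ifs
  exacts [analyticAt_lapse_inv x, analyticAt_const]

/-- A_r² = κ⁴r²/(1 + κ²r²)², so the apparent pole κ⁻⁴ disappears and the product is analytic in κ²
at 0. -/
theorem acceleration_mul_acceleration {κ : ℂ} {x : Fin 4 → ℝ} (hκ : κ ≠ 0)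
    (h : lapse (κ ^ 2) x ≠ 0) (h1 : x 1 ≠ 0) (h2 : Real.sin (x 2) ≠ 0) (μ ν : Fin 4) :
    (1 + (x 1 : ℂ) ^ 2 * κ ^ 2) / ((x 1 : ℂ) ^ 2 * κ ^ 4)
      * acceleration (κ ^ 2) x μ * acceleration (κ ^ 2) x ν = radialSq (κ ^ 2) x μ ν := by
  have h1' : (x 1 : ℂ) ≠ 0 := by exact_mod_cast h1
  rw [acceleration_eq h h1 h2, acceleration_eq h h1 h2, radialSq,
    show 1 + (x 1 : ℂ) ^ 2 * κ ^ 2 = lapse (κ ^ 2) x by rw [lapse]; ring]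
  by_cases hμ : μ = 1 <;> by_cases hν : ν = 1 <;> simp only [hμ, hν, if_true, if_false, true_and,
    false_and, and_false, mul_zero, zero_mul]
  field_simp

/-- The coefficient of `κ * S₀` in the boundary term. -/
noncomputable def coeffS0 (z : ℂ) (x : Fin 4 → ℝ) (μ ν : Fin 4) : ℂ :=
  1 / (8 * (π : ℂ) ^ 2 * (x 1 : ℂ) ^ 3) * ((1 - z * (x 1 : ℂ) ^ 2) / 6 * metric z x μ ν
    + (3 * z * (x 1 : ℂ) ^ 2 - 1) / 6 * velocitySq z x μ ν
    + (3 * lapse z x - 4 * z * (x 1 : ℂ) ^ 2) / 6 * radialSq z x μ ν)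

/-- The coefficient of `κ ^ 2 * C₁` in the boundary term. -/
noncomputable def coeffC1 (z : ℂ) (x : Fin 4 → ℝ) (μ ν : Fin 4) : ℂ :=
  1 / (8 * (π : ℂ) ^ 2 * (x 1 : ℂ) ^ 2) * (-1 / 3 * metric z x μ ν
    + (1 - 2 / 3 * (lapse z x)⁻¹) * velocitySq z x μ ν
    + (2 / 3 * z * (x 1 : ℂ) ^ 2 * (lapse z x)⁻¹ - 1) * radialSq z x μ ν)

/-- The coefficient of `κ ^ 3 * S₂` in the boundary term. -/
noncomputable def coeffS2 (z : ℂ) (x : Fin 4 → ℝ) (μ ν : Fin 4) : ℂ :=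
  1 / (8 * (π : ℂ) ^ 2 * (x 1 : ℂ)) * (lapse z x)⁻¹ * (-2 / 3 * metric z x μ ν
    + 2 * velocitySq z x μ ν - 2 / 3 * radialSq z x μ ν)

theorem analyticAt_coeffS0 (x : Fin 4 → ℝ) (μ ν : Fin 4) :
    AnalyticAt ℂ (fun z => coeffS0 z x μ ν) 0 := by
  have hl := analyticAt_lapse x
  have hg := analyticAt_metric x μ ν
  have hu := analyticAt_velocitySq x μ ν
  have hv := analyticAt_radialSq x μ ν
  unfold coeffS0
  simp only [div_eq_mul_inv]
  fun_prop

theorem analyticAt_coeffC1 (x : Fin 4 → ℝ) (μ ν : Fin 4) :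
    AnalyticAt ℂ (fun z => coeffC1 z x μ ν) 0 := by
  have hl := analyticAt_lapse_inv x
  have hg := analyticAt_metric x μ ν
  have hu := analyticAt_velocitySq x μ ν
  have hv := analyticAt_radialSq x μ ν
  unfold coeffC1
  fun_prop

theorem analyticAt_coeffS2 (x : Fin 4 → ℝ) (μ ν : Fin 4) :
    AnalyticAt ℂ (fun z => coeffS2 z x μ ν) 0 := by
  have hl := analyticAt_lapse_inv x
  have hg := analyticAt_metric x μ ν
  have hu := analyticAt_velocitySq x μ ν
  have hv := analyticAt_radialSq x μ ν
  unfold coeffS2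
  fun_prop

/-- Collecting by series separates the parity in κ: S₀, C₁, S₂ carry κ, κ², κ³ times functions of κ²
that are analytic at 0. -/
theorem boundaryTensor_eq {κ : ℂ} {x : Fin 4 → ℝ} (T₀ : ℝ) (hκ : κ ≠ 0)
    (h : lapse (κ ^ 2) x ≠ 0) (h1 : x 1 ≠ 0) (h2 : Real.sin (x 2) ≠ 0) (μ ν : Fin 4) :
    boundaryTensor T₀ κ x μ ν
      = κ * coeffS0 (κ ^ 2) x μ ν * sinSeries 0 κ (1 / T₀) (x 1)
        + κ ^ 2 * coeffC1 (κ ^ 2) x μ ν * cosSeries 1 κ (1 / T₀) (x 1)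
        + κ ^ 3 * coeffS2 (κ ^ 2) x μ ν * sinSeries 2 κ (1 / T₀) (x 1) := by
  have h1' : (x 1 : ℂ) ≠ 0 := by exact_mod_cast h1
  have hπ : (π : ℂ) ≠ 0 := by exact_mod_cast Real.pi_ne_zero
  have hu := velocity_mul_velocity (κ ^ 2) x μ ν
  have ha := acceleration_mul_acceleration hκ h h1 h2 μ ν
  rw [← velocitySq] at hu
  simp only [boundaryTensor, coeffS0, coeffC1, coeffS2]
  have hl : 1 + κ ^ 2 * (x 1 : ℂ) ^ 2 = lapse (κ ^ 2) x := rfl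
  rw [← hu, ← ha, hl]
  generalize sinSeries 0 κ (1 / T₀) (x 1) = s0
  generalize cosSeries 1 κ (1 / T₀) (x 1) = c1
  generalize sinSeries 2 κ (1 / T₀) (x 1) = s2
  field_simp
  ring

/-- The temperature-independent parts κr/4, (1 + κ²r²)/8 and -κr(1 + κ²r²)/8 of S₀, C₁, S₂ cancel
separately in front of the metric, the velocity and the acceleration terms. -/
theorem vacuum_cancellation {κ : ℂ} {x : Fin 4 → ℝ}
    (h : lapse (κ ^ 2) x ≠ 0) (h1 : x 1 ≠ 0) (μ ν : Fin 4) :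
    κ * coeffS0 (κ ^ 2) x μ ν * (κ * x 1 / 4)
        + κ ^ 2 * coeffC1 (κ ^ 2) x μ ν * (lapse (κ ^ 2) x / 8)
        - κ ^ 3 * coeffS2 (κ ^ 2) x μ ν * (κ * x 1 * lapse (κ ^ 2) x / 8) = 0 := by
  have h1' : (x 1 : ℂ) ≠ 0 := by exact_mod_cast h1
  have hπ : (π : ℂ) ≠ 0 := by exact_mod_cast Real.pi_ne_zero
  simp only [coeffS0, coeffC1, coeffS2]
  generalize metric (κ ^ 2) x μ ν = G
  generalize velocitySq (κ ^ 2) x μ ν = U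
  generalize radialSq (κ ^ 2) x μ ν = V
  have hl : lapse (κ ^ 2) x = 1 + κ ^ 2 * (x 1 : ℂ) ^ 2 := rfl
  field_simp
  rw [hl]
  ring

/-- The part of the boundary term that is odd in `κ`. -/
noncomputable def oddPart (s : ℂ) (β : ℝ) (x : Fin 4 → ℝ) (μ ν : Fin 4) (κ : ℂ) : ℂ :=
  -s * (coeffS0 (κ ^ 2) x μ ν * (Complex.arctan (κ * x 1) / β)
    + κ * coeffC1 (κ ^ 2) x μ ν / (2 * β))

theorem analyticAt_oddPart (s : ℂ) (β : ℝ) (x : Fin 4 → ℝ) (μ ν : Fin 4) :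
    AnalyticAt ℂ (oddPart s β x μ ν) 0 := by
  have hsq : AnalyticAt ℂ (fun κ : ℂ => κ ^ 2) 0 := by fun_prop
  have h0 : AnalyticAt ℂ (fun κ : ℂ => coeffS0 (κ ^ 2) x μ ν) 0 :=
    AnalyticAt.fun_comp (g := fun z => coeffS0 z x μ ν) (by simpa using analyticAt_coeffS0 x μ ν) hsq
  have h1 : AnalyticAt ℂ (fun κ : ℂ => coeffC1 (κ ^ 2) x μ ν) 0 :=
    AnalyticAt.fun_comp (g := fun z => coeffC1 z x μ ν) (by simpa using analyticAt_coeffC1 x μ ν) hsq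
  have h2 : AnalyticAt ℂ (fun κ : ℂ => Complex.arctan (κ * x 1)) 0 :=
    AnalyticAt.fun_comp (g := Complex.arctan) (by simpa using analyticAt_arctan_zero) (by fun_prop)
  unfold oddPart
  simp only [div_eq_mul_inv]
  fun_prop

theorem eventually_oddPart_neg (s : ℂ) (β : ℝ) (x : Fin 4 → ℝ) (μ ν : Fin 4) :
    ∀ᶠ κ in 𝓝 0, oddPart s β x μ ν (-κ) = -oddPart s β x μ ν κ := by
  have h : Tendsto (fun κ : ℂ => κ * x 1) (𝓝 0) (𝓝 0) := by
    simpa using (continuous_mul_const (x 1 : ℂ)).tendsto 0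
  filter_upwards [h.eventually eventually_arctan_neg] with κ hκ
  rw [oddPart, oddPart, neg_mul κ, hκ, neg_sq]
  ring

/-- The explicit bulk expansion is exactly the distilled tensor, and the 1/w parts of S₀ and C₁ are
the odd part. Only the remainders are left, with coefficients bounded near 0. -/
theorem vacuumSubtractedTensor_sub_eq (bc : BoundaryCondition) {T₀ : ℝ} (hT : 0 < T₀) {κ : ℂ}
    {x : Fin 4 → ℝ} (hκ : κ ≠ 0) (h : lapse (κ ^ 2) x ≠ 0) (h1 : x 1 ≠ 0)
    (h2 : Real.sin (x 2) ≠ 0) (μ ν : Fin 4) :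
    vacuumSubtractedTensor bc T₀ κ x μ ν - distilledTensor T₀ (κ ^ 2) x μ ν
        - oddPart bc.sign (1 / T₀) x μ ν κ
      = 1 / (6 * (π : ℂ) ^ 2) * κ ^ 4 * (lapse (κ ^ 2) x)⁻¹ ^ 2 * radiationTensor (κ ^ 2) x μ ν
          * (f3 (κ * ((1 / T₀ : ℝ) : ℂ)) - π ^ 4 / (15 * (κ * ((1 / T₀ : ℝ) : ℂ)) ^ 4) + 1 / 240)
        + bc.sign * (κ * coeffS0 (κ ^ 2) x μ ν * (sinSeries 0 κ (1 / T₀) (x 1)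
              + Complex.arctan (κ * x 1) / (κ * ((1 / T₀ : ℝ) : ℂ)) - κ * x 1 / 4)
          + κ ^ 2 * coeffC1 (κ ^ 2) x μ ν * (cosSeries 1 κ (1 / T₀) (x 1)
              + 1 / (2 * (κ * ((1 / T₀ : ℝ) : ℂ))) - lapse (κ ^ 2) x / 8)
          + κ ^ 3 * coeffS2 (κ ^ 2) x μ ν * (sinSeries 2 κ (1 / T₀) (x 1)
              + κ * x 1 * lapse (κ ^ 2) x / 8)) := by
  have hv := vacuum_cancellation h h1 μ ν
  have hπ : (π : ℂ) ≠ 0 := by exact_mod_cast Real.pi_ne_zero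
  have hT' : (T₀ : ℂ) ≠ 0 := by exact_mod_cast hT.ne'
  rw [vacuumSubtractedTensor, renormalizedTensor, boundaryTensor_eq T₀ hκ h h1 h2, bulkTensor,
    distilledTensor, oddPart, ← lapse]
  push_cast
  generalize coeffS0 (κ ^ 2) x μ ν = p0 at *
  generalize coeffC1 (κ ^ 2) x μ ν = p1 at *
  generalize coeffS2 (κ ^ 2) x μ ν = p2 at *
  generalize lapse (κ ^ 2) x = l at *
  generalize radiationTensor (κ ^ 2) x μ ν = R
  generalize sinSeries 0 κ (1 / T₀) (x 1) = s0
  generalize cosSeries 1 κ (1 / T₀) (x 1) = c1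
  generalize sinSeries 2 κ (1 / T₀) (x 1) = s2
  generalize Complex.arctan (κ * x 1) = a
  generalize f3 _ = f
  have e1 : 1 / (6 * (π : ℂ) ^ 2) * (κ ^ 2 / l) ^ 2 * f * R
      - ((π : ℂ) ^ 2 / 90 * T₀ ^ 4 - (κ ^ 2) ^ 2 / (1440 * π ^ 2)) * (1 / l) ^ 2 * R
      = 1 / (6 * (π : ℂ) ^ 2) * κ ^ 4 * l⁻¹ ^ 2 * R
          * (f - π ^ 4 / (15 * (κ * (1 / T₀)) ^ 4) + 1 / 240) := by
    field_simp
    ring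
  have e2 : κ * p0 * (a / (κ * (1 / T₀))) + κ ^ 2 * p1 * (1 / (2 * (κ * (1 / T₀))))
      = p0 * (a / (1 / T₀)) + κ * p1 / (2 * (1 / T₀)) := by
    field_simp
  linear_combination e1 - bc.sign * e2 + bc.sign * hv

theorem isBigO_vacuumSubtractedTensor (bc : BoundaryCondition) {T₀ : ℝ} (hT : 0 < T₀)
    {x : Fin 4 → ℝ} (hx : x ∈ chart) (μ ν : Fin 4) (N : ℕ) :
    (fun z => vacuumSubtractedTensor bc T₀ (root z) x μ ν - distilledTensor T₀ z x μ ν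
      - oddPart bc.sign (1 / T₀) x μ ν (root z)) =O[𝓝[domain T₀ (x 1) \ {0}] 0]
        fun z => ‖z‖ ^ N := by
  have hβ : 0 < 1 / T₀ := by positivity
  obtain ⟨c, hc, hsec⟩ := eventually_domain_sector hT hx.1
  -- Order 2N in κ is order N in z.
  obtain ⟨K, ρ, hρ, hb⟩ := f3_remainder hβ hc (2 * N)
  obtain ⟨K', ρ', hρ', hb'⟩ := boundary_remainders hβ hc hx.1 (2 * N)
  have hroot := tendsto_root.mono_left (nhdsWithin_le_nhds (s := domain T₀ (x 1) \ {0}))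
  have hle : 𝓝[domain T₀ (x 1) \ {0}] (0 : ℂ) ≤ 𝓝 0 := nhdsWithin_le_nhds
  have hlapse : ∀ᶠ z in 𝓝[domain T₀ (x 1) \ {0}] 0, lapse z x ≠ 0 :=
    hle ((analyticAt_lapse x).continuousAt.eventually_ne (by simp [lapse_zero]))
  have hsmall : ∀ δ : ℝ, 0 < δ → ∀ᶠ z in 𝓝[domain T₀ (x 1) \ {0}] 0, ‖root z‖ < δ := by
    intro δ hδ
    filter_upwards [hroot (Metric.ball_mem_nhds 0 hδ)] with z hz
    simpa using hz
  have hne : ∀ᶠ z in 𝓝[domain T₀ (x 1) \ {0}] 0, root z ≠ 0 := by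
    filter_upwards [self_mem_nhdsWithin] with z hz h0
    have := root_re_pos hz.1.1
    simp [h0] at this
  have hpow : ∀ z, ‖root z‖ ^ (2 * N) = ‖z‖ ^ N := fun z => by rw [pow_mul, norm_root_sq]
  have one : ∀ {p : ℂ → ℂ}, ContinuousAt p 0 →
      p =O[𝓝[domain T₀ (x 1) \ {0}] 0] fun _ => (1 : ℝ) := fun hp => (hp.isBigO_one ℝ).mono hle
  have rootpow : ∀ k : ℕ, (fun z => root z ^ k) =O[𝓝[domain T₀ (x 1) \ {0}] 0]
      fun _ => (1 : ℝ) := fun k => (hroot.pow k).isBigO_one ℝ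
  have mulO : ∀ {p q : ℂ → ℂ}, p =O[𝓝[domain T₀ (x 1) \ {0}] 0] (fun _ => (1 : ℝ)) →
      q =O[𝓝[domain T₀ (x 1) \ {0}] 0] (fun z => ‖z‖ ^ N) →
      (fun z => p z * q z) =O[𝓝[domain T₀ (x 1) \ {0}] 0] (fun z => ‖z‖ ^ N) := by
    intro p q hp hq
    simpa using hp.mul hq
  have r3 : (fun z => f3 (root z * ((1 / T₀ : ℝ) : ℂ))
      - π ^ 4 / (15 * (root z * ((1 / T₀ : ℝ) : ℂ)) ^ 4) + 1 / 240)
        =O[𝓝[domain T₀ (x 1) \ {0}] 0] fun z => ‖z‖ ^ N := by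
    refine IsBigO.of_bound K ?_
    filter_upwards [hsec, hne, hsmall ρ hρ] with z h1 h2 h3
    rw [norm_pow, norm_norm, ← hpow]
    exact hb _ h2 h3 h1
  have rb := ((hsec.and hne).and ((hsmall ρ' hρ').and self_mem_nhdsWithin)).mono fun z h =>
    hb' _ h.1.2 h.2.1 h.1.1 (two_mul_abs_im_lt_of_mem_domain hT h.2.2.1)
  simp only [root_sq, hpow] at rb
  have s2 : (fun z => sinSeries 2 (root z) (1 / T₀) (x 1) + root z * x 1 * lapse z x / 8)
      =O[𝓝[domain T₀ (x 1) \ {0}] 0] fun z => ‖z‖ ^ N := by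
    refine IsBigO.of_bound K' ?_
    filter_upwards [rb] with z h
    rw [norm_pow, norm_norm]
    exact h.1
  have c1 : (fun z => cosSeries 1 (root z) (1 / T₀) (x 1)
      + 1 / (2 * (root z * ((1 / T₀ : ℝ) : ℂ))) - lapse z x / 8)
      =O[𝓝[domain T₀ (x 1) \ {0}] 0] fun z => ‖z‖ ^ N := by
    refine IsBigO.of_bound K' ?_
    filter_upwards [rb] with z h
    rw [norm_pow, norm_norm]
    exact h.2.1
  have s0 : (fun z => sinSeries 0 (root z) (1 / T₀) (x 1)
      + Complex.arctan (root z * x 1) / (root z * ((1 / T₀ : ℝ) : ℂ)) - root z * x 1 / 4)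
      =O[𝓝[domain T₀ (x 1) \ {0}] 0] fun z => ‖z‖ ^ N := by
    refine IsBigO.of_bound K' ?_
    filter_upwards [rb] with z h
    rw [norm_pow, norm_norm]
    exact h.2.2
  have q3 := (((rootpow 4).const_mul_left (1 / (6 * (π : ℂ) ^ 2))).mul
    ((one (analyticAt_lapse_inv x).continuousAt).pow 2)).mul
      (one (analyticAt_radiationTensor x μ ν).continuousAt)
  have q0 := (rootpow 1).mul (one (analyticAt_coeffS0 x μ ν).continuousAt)
  have q1 := (rootpow 2).mul (one (analyticAt_coeffC1 x μ ν).continuousAt)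
  have q2 := (rootpow 3).mul (one (analyticAt_coeffS2 x μ ν).continuousAt)
  simp only [one_pow, mul_one] at q3 q0 q1 q2
  refine ((mulO q3 r3).add ((((mulO q0 s0).add (mulO q1 c1)).add
    (mulO q2 s2)).const_mul_left bc.sign)).congr' ?_ EventuallyEq.rfl
  filter_upwards [hlapse, hne] with z h1 h2
  have := vacuumSubtractedTensor_sub_eq bc hT h2 (by rwa [root_sq]) hx.1.ne'
    (sin_ne_zero_of_mem_chart hx) μ ν
  simp only [root_sq] at this
  rw [this, pow_one, root_sq]

theorem isDistillate_vacuumSubtractedTensor_iff (bc : BoundaryCondition) {T₀ : ℝ} (hT : 0 < T₀)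
    {x : Fin 4 → ℝ} (hx : x ∈ chart) (μ ν : Fin 4) (g : ℂ → ℂ) :
    IsDistillate (fun z => vacuumSubtractedTensor bc T₀ (root z) x μ ν) (domain T₀ (x 1)) 0 g ↔
      g =ᶠ[𝓝 0] fun z => distilledTensor T₀ z x μ ν :=
  isDistillate_iff_of_hasTransseries (zero_mem_closure_domain (x 1) hT)
    (hasTransseries_of_isBigO (analyticAt_distilledTensor T₀ x μ ν)
      (analyticAt_oddPart bc.sign (1 / T₀) x μ ν) (isBigO_vacuumSubtractedTensor bc hT hx μ ν))
    (analyticAt_distilledTensor T₀ x μ ν)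
    (coeff_halfTransseries_natCast (eventually_oddPart_neg bc.sign (1 / T₀) x μ ν)) g

end AdSDistillate

theorem mainTheorem1 :
    -- asymptotics of the bulk series, to all orders and uniformly in closed subsectors of `Re κ > 0`
    (∀ β₀ : ℝ, 0 < β₀ → ∀ ε : ℝ, 0 < ε → ∀ N : ℕ,
      (fun κ : ℂ => κ ^ 3 * AdSDistillate.f3 (κ * (β₀ : ℂ))
          - ((Real.pi : ℂ) ^ 4 / 15 * (1 / (κ * (β₀ : ℂ) ^ 4)) - κ ^ 3 / 240))
        =O[𝓝[{κ : ℂ | κ ≠ 0 ∧ |κ.arg| ≤ Real.pi / 2 - ε}] 0] (fun κ : ℂ => ‖κ‖ ^ N)) ∧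
    -- the distillate in `κ² = 0`, at fixed temperature and space-time point, exists and is unique
    (∀ (bc : AdSDistillate.BoundaryCondition) (T₀ : ℝ), 0 < T₀ →
      ∀ x ∈ AdSDistillate.chart, ∀ (μ ν : Fin 4) (g : ℂ → ℂ),
        AdSDistillate.IsDistillate
            (fun z : ℂ =>
              AdSDistillate.vacuumSubtractedTensor bc T₀ (AdSDistillate.root z) x μ ν)
            (AdSDistillate.domain T₀ (x 1)) 0 g ↔
          g =ᶠ[𝓝 0] fun z : ℂ => AdSDistillate.distilledTensor T₀ z x μ ν) ∧
    -- for a real space-time (`κ > 0`) the distillate is traceless and covariantly conserved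
    (∀ T₀ : ℝ, 0 < T₀ → ∀ κ : ℝ, 0 < κ → ∀ x ∈ AdSDistillate.chart,
      AdSDistillate.traceTensor ((κ : ℂ) ^ 2)
          (AdSDistillate.distilledTensor T₀ ((κ : ℂ) ^ 2)) x = 0 ∧
      ∀ ν : Fin 4, AdSDistillate.divergence ((κ : ℂ) ^ 2)
          (AdSDistillate.distilledTensor T₀ ((κ : ℂ) ^ 2)) x ν = 0) ∧
    -- it vanishes at `T₀ = κ / 2π`, and at no other `T₀ ≥ 0`
    (∀ T₀ : ℝ, 0 ≤ T₀ → ∀ κ : ℝ, 0 < κ → ∀ x ∈ AdSDistillate.chart,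
      (∀ μ ν : Fin 4, AdSDistillate.distilledTensor T₀ ((κ : ℂ) ^ 2) x μ ν = 0) ↔
        T₀ = κ / (2 * Real.pi)) := by
  open AdSDistillate in
  refine ⟨fun β₀ hβ ε hε N => isBigO_bulk_sector hβ hε N,
    fun bc T₀ hT x hx μ ν g => isDistillate_vacuumSubtractedTensor_iff bc hT hx μ ν g,
    fun T₀ _ κ _ x hx => ⟨traceTensor_distilledTensor T₀ (lapse_ofReal_sq_ne_zero κ x) hx.1.ne'
      (sin_ne_zero_of_mem_chart hx), divergence_distilledTensor T₀ κ hx⟩,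
    fun T₀ hT κ hκ x _ => distilledTensor_eq_zero_iff hT hκ x⟩
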